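/- **Setting.** Let $d\ge 1$ and $\beta\in(0,\infty)$. For $k\in\mathbb N=\{1,2,\dots\}$ and $x,y\in\mathbb R^d$ let $\mu^{(k)}_{x,y}$ be the canonical Brownian bridge measure on continuous paths $f\colon[0,k\beta]\to\mathbb R^d$ for Brownian motion with generator $\Delta$, that is, $\mu^{(k)}_{x,y}(A)=\mathbb P_x(B\in A;B_{k\beta}\in\mathrm dy)/\mathrm dy$, of total mass $(4\pi k\beta)^{-d/2}\mathrm e^{-|x-y|^2/(4k\beta)}$. Such an $f$ has *length* $\ell(f)=k$, *particles* $f(0),f(\beta),\dots,f((k-1)\beta)$ and *legs* $f_i=f((i-1)\beta+\cdot)|_{[0,\beta]}$, $i=1,\dots,k$. For a centred box $\Lambda=[-a,a]^d$ and $\mathrm{bc}\in\{\mathrm{per},0,\mathrm{par}\}$ let $\mu^{(k,\Lambda,0)}_{x,y}$ and $\mu^{(k,\Lambda,\mathrm{par})}_{x,y}$ be the restrictions of $\mu^{(k)}_{x,y}$ to paths that stay in $\Lambda$, respectively to paths with $f(l\beta)\in\Lambda$ for $l=0,1,\dots,k$, and let $\mu^{(k,\Lambda,\mathrm{per})}_{x,y}$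 be the bridge measure of Brownian motion on the torus $\mathbb R^d/2a\mathbb Z^d$, that is, $\sum_{n\in\mathbb Z^d}\mu^{(k)}_{x,y+2an}$ on lifted paths. Put $$\nu^{(\mathrm{bc})}_\Lambda(\mathrm dx,\mathrm df)=\sum_{k\in\mathbb N}\frac1k\,\mathrm dx\otimes\mu^{(k,\Lambda,\mathrm{bc})}_{x,x}(\mathrm df),\qquad x\in\Lambda .$$ *Assumption (V).* The potential $v\colon\mathbb R^d\to[0,\infty)$ is bounded and continuous with compact support, and there is $C>0$ such that for every box $W=\prod_i[\alpha_i,\gamma_i]\supset[-1,1]^d$, every $k\in\mathbb N$ and all $x_1,\dots,x_k\in W$, $$\sum_{1\le i<j\le k}v(x_i-x_j)\ge C\Big(\frac{k^2}{|W|}-k\Big).$$ For a finite configuration $\omega=\sum_{x\in\zeta}\delta_{(x,f_x)}$ let $$\Phi_{\Lambda,\Lambda}(\omega)=\frac12\sum_{x,y\in\zeta}\ \sum_{i=1}^{\ell(f_x)}\sum_{j=1}^{\ell(f_y)}\mathbf 1\{(x,i)\ne(y,j)\}\int_0^\beta v\big(f_{x,i}(s)-f_{y,j}(s)\big)\,\mathrm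 ds ,$$ where for $\mathrm{bc}=\mathrm{per}$ the potential $v$ is replaced by its periodisation $\sum_{n\in\mathbb Z^d}v(\cdot+2an)$. Let $\widehat{\mathtt Q}^{(\Lambda,\mathrm{bc})}$ be the law with density proportional to $\mathrm e^{-\Phi_{\Lambda,\Lambda}}$ with respect to the Poisson point process with intensity measure $\nu=\nu^{(\mathrm{bc})}_\Lambda$; that is, under $\widehat{\mathtt Q}^{(\Lambda,\mathrm{bc})}$, $$\widehat{\mathtt Q}^{(\Lambda,\mathrm{bc})}(A)=\frac{\sum_{n\ge0}\frac1{n!}\int \mathbf 1_A\,\mathrm e^{-\Phi_{\Lambda,\Lambda}}\,\mathrm d\nu^{\otimes n}}{\sum_{n\ge0}\frac1{n!}\int \mathrm e^{-\Phi_{\Lambda,\Lambda}}\,\mathrm d\nu^{\otimes n}},$$ where the integrands are evaluated at $\omega=\sum_{p=1}^n\delta_{(x_p,f_p)}$. (This formula is the definition for $\mathrm{bc}=\mathrm{per}$, where $\nu$ has infinite total mass.) For $r>0$ call a loop *non-crossing* if all its particles (for $\mathrm{bc}=\mathrm{per}$: their representatives in $\Lambda$) lie in one of the subboxes $z+[-r,r]^d$,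 $z\in2r\mathbb Z^d$, and *crossing* otherwise. For $L\in\mathbb N_0$ let $$\mathfrak N^{(\ell,r)}_{\Lambda,\le L}(\omega)=\sum_{x\in\zeta}\ell(f_x)\mathbf 1\{f_x\text{ crossing},\ \ell(f_x)\le L\},\qquad \mathfrak N^{(\ell,\neg r)}_{\Lambda,>L}(\omega)=\sum_{x\in\zeta}\ell(f_x)\mathbf 1\{f_x\text{ non-crossing},\ \ell(f_x)>L\}.$$ **Lemma 3.2 (Equivalence of condensate notions).** Suppose that $v$ satisfies Assumption (V). Fix $\rho\in(0,\infty)$ and centred boxes $\Lambda_N=[-a_N,a_N]^d$, $a_N>0$, with $|\Lambda_N|/N\to1/\rho$ as $N\to\infty$. Then there are sequences $(L_R^{\le})_{R\in\mathbb N}$ and $(L_R^{>})_{R\in\mathbb N}$ of nonnegative integers, both tending to $\infty$ as $R\to\infty$, such that the following holds for all $r_{R,N}$ ($R,N\in\mathbb N$) with $\lim_{N\to\infty}r_{R,N}=R$ for each $R$ and such that, for each $R$ and all sufficiently large $N$, the box $\Lambda_N$ is a union of subboxes $z+[-r_{R,N},r_{R,N}]^d$ with $z\in2r_{R,N}\mathbb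 Z^d$: for every $\mathrm{bc}\in\{\mathrm{per},0,\mathrm{par}\}$ and every $\varepsilon\in(0,1)$, $$\limsup_{R\to\infty}\limsup_{N\to\infty}\frac1{|\Lambda_N|}\log\widehat{\mathtt Q}^{(\Lambda_N,\mathrm{bc})}\Big(\mathfrak N^{(\ell,r_{R,N})}_{\Lambda_N,\le L_R^{\le}}>\varepsilon|\Lambda_N|\Big)=-\infty,$$ $$\limsup_{R\to\infty}\limsup_{N\to\infty}\frac1{|\Lambda_N|}\log\widehat{\mathtt Q}^{(\Lambda_N,\mathrm{bc})}\Big(\mathfrak N^{(\ell,\neg r_{R,N})}_{\Lambda_N,>L_R^{>}}>\varepsilon|\Lambda_N|\Big)=-\infty.$$ -/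

import Mathlib

open scoped NNReal ENNReal

namespace BoseLoops

noncomputable section

/-- The Euclidean space `ℝ^d`. -/
abbrev Space (d : ℕ) : Type := EuclideanSpace ℝ (Fin d)

/-! ### Boxes and the interaction potential -/

/-- The cube `c + [-r, r]^d`. -/
def cube {d : ℕ} (c : Space d) (r : ℝ) : Set (Space d) :=
  {y | ∀ i, |y i - c i| ≤ r}

/-- The volume `(2 a)^d` of the centred box `Λ = [-a, a]^d`. -/
def boxVolume (d : ℕ) (a : ℝ) : ℝ := (2 * a) ^ d

/-- The lattice point `s • n`, for `n ∈ ℤ^d`. -/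
def latticePoint {d : ℕ} (s : ℝ) (n : Fin d → ℤ) : Space d :=
  WithLp.toLp 2 fun i => s * (n i : ℝ)

/-- The box `[-a, a]^d` is the union of subboxes `z + [-r, r]^d` with `z` in a subset of
`2 r ℤ^d`. -/
def IsPartitioned (d : ℕ) (a r : ℝ) : Prop :=
  ∃ Z : Set (Fin d → ℤ),
    cube (0 : Space d) a = ⋃ n ∈ Z, cube (latticePoint (2 * r) n) r

/-- The assumption on the pair potential: nonnegative, bounded, continuous, of compact support,
and superstable on all boxes `∏ [lo i, hi i]` that contain `[-1, 1]^d`. -/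
structure AssumptionV {d : ℕ} (v : Space d → ℝ) : Prop where
  nonneg : ∀ x, 0 ≤ v x
  bounded : ∃ M, ∀ x, v x ≤ M
  continuous : Continuous v
  compactSupport : HasCompactSupport v
  superstable : ∃ C > 0, ∀ lo hi : Fin d → ℝ, (∀ i, lo i ≤ -1 ∧ 1 ≤ hi i) →
    ∀ (k : ℕ) (x : Fin k → Space d), (∀ p i, lo i ≤ x p i ∧ x p i ≤ hi i) →
      C * ((k : ℝ) ^ 2 / (∏ i, (hi i - lo i)) - k)
        ≤ ∑ p, ∑ q ∈ Finset.univ.filter (fun q => p < q), v (x p - x q)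

/-! ### Path spaces and Wiener measure -/

/-- The σ-algebra on continuous paths generated by the evaluations (for paths on an interval it is
the Borel σ-algebra of locally uniform convergence). -/
instance pathMeasurableSpace (T : Type*) [TopologicalSpace T] (d : ℕ) :
    MeasurableSpace C(T, Space d) :=
  MeasurableSpace.comap (fun f t => f t) MeasurableSpace.pi

/-- `W` is Wiener measure on `C([0, ∞), ℝ^d)`: under `W`, the coordinate process is a standard
`d`-dimensional Brownian motion started at `0`, that is, its `d` components are independent
standard Brownian motions. This determines `W` uniquely. -/
structure IsWienerMeasure {d : ℕ} (W : MeasureTheory.Measure C(ℝ≥0, Space d)) : Prop where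
  brownian : ∀ i : Fin d, ProbabilityTheory.IsBrownianReal (fun t w => w t i) W
  indep : ProbabilityTheory.iIndepFun (fun (i : Fin d) (w : C(ℝ≥0, Space d)) (t : ℝ≥0) => w t i) W

/-- `C_k`: continuous paths `[0, k β] → ℝ^d`. -/
abbrev PathSpace (d : ℕ) (β : ℝ≥0) (k : ℕ) : Type :=
  C(Set.Iic ((k : ℝ≥0) * β), Space d)

/-- The disjoint union of the spaces `C_k`; the first component `k` is the length `ℓ(f)`. -/
abbrev Path (d : ℕ) (β : ℝ≥0) : Type := Σ k : ℕ, PathSpace d β k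

/-- The value `f(t)` (only used for `0 ≤ t ≤ ℓ(f) β`). -/
def Path.eval {d : ℕ} {β : ℝ≥0} (f : Path d β) (t : ℝ) : Space d :=
  f.2 ⟨min t.toNNReal ((f.1 : ℝ≥0) * β), Set.mem_Iic.2 (min_le_right _ _)⟩

/-- The path `t ↦ x + (t/T) (y - x) + √2 (w(t) - (t/T) w(T))` on `[0, T]`. If `w` is a standard
Brownian motion, this is a Brownian bridge from `x` to `y` in time `T` for the Brownian motion
with generator `Δ` (that is, with variance `2 t` per coordinate). -/
def bridgePath {d : ℕ} (T : ℝ≥0) (x y : Space d) (w : C(ℝ≥0, Space d)) :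
    C(Set.Iic T, Space d) where
  toFun t := x + ((t : ℝ≥0) / T : ℝ) • (y - x)
    + √2 • (w (t : ℝ≥0) - ((t : ℝ≥0) / T : ℝ) • w T)
  continuous_toFun := by fun_prop

/-- The Gaussian kernel `g_T(x, y) = (4 π T)^{-d/2} exp(-|x - y|² / (4 T))` of `e^{T Δ}`. -/
def heatKernel {d : ℕ} (T : ℝ) (x y : Space d) : ℝ :=
  (4 * Real.pi * T) ^ (-(d : ℝ) / 2) * Real.exp (-‖x - y‖ ^ 2 / (4 * T))

/-- The canonical (unnormalised) free Brownian bridge measure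
`μ^{(k)}_{x,y}(A) = P_x(B ∈ A; B_{kβ} ∈ dy) / dy`, of total mass `g_{kβ}(x, y)`. -/
def bridgeMeasure {d : ℕ} (W : MeasureTheory.Measure C(ℝ≥0, Space d)) (β : ℝ≥0) (k : ℕ)
    (x y : Space d) : MeasureTheory.Measure (PathSpace d β k) :=
  ENNReal.ofReal (heatKernel ((k : ℝ) * β) x y) • W.map (bridgePath ((k : ℝ≥0) * β) x y)

/-! ### Boundary conditions -/

/-- The boundary conditions: periodic, Dirichlet zero, and particle boundary condition. -/
inductive BC where
  | per
  | zero
  | par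

/-- The bridge measure `μ^{(k,Λ,bc)}_{x,y}` in the box `Λ = [-a, a]^d`.
* Periodic: Brownian motion on the torus `ℝ^d / 2aℤ^d`. A continuous path on the torus with
  starting point in `Λ` is represented by its lift to `ℝ^d` with the same starting point; the lift
  of a torus path from `x` to `y` ends in `y + 2 a n` for some `n ∈ ℤ^d`.
* Dirichlet zero: Brownian motion killed on leaving `Λ`.
* Particle: all particles `f(0), f(β), …, f(kβ)` are in `Λ`. -/
def bcBridgeMeasure {d : ℕ} (W : MeasureTheory.Measure C(ℝ≥0, Space d)) (β : ℝ≥0) (bc : BC)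
    (a : ℝ) (k : ℕ) (x y : Space d) : MeasureTheory.Measure (PathSpace d β k) :=
  match bc with
  | .per => MeasureTheory.Measure.sum fun n : Fin d → ℤ =>
      bridgeMeasure W β k x (y + latticePoint (2 * a) n)
  | .zero => (bridgeMeasure W β k x y).restrict {f | ∀ t, f t ∈ cube 0 a}
  | .par => (bridgeMeasure W β k x y).restrict
      {f | ∀ l ≤ k, Path.eval ⟨k, f⟩ ((l : ℝ) * β) ∈ cube 0 a}

/-- The position in the box `Λ = [-a, a]^d` of a point: in the periodic case its representative
modulo `2 a ℤ^d` in `[-a, a)^d`, otherwise the point itself. -/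
def position {d : ℕ} (bc : BC) (a : ℝ) (y : Space d) : Space d :=
  match bc with
  | .per => WithLp.toLp 2 fun i => y i - 2 * a * (⌊(y i + a) / (2 * a)⌋ : ℝ)
  | .zero => y
  | .par => y

/-- The pair potential as seen in the box: in the periodic case the potential on the torus, that
is, the periodisation of `v` (a finite sum as `v` has compact support), otherwise `v` itself. -/
def bcPotential {d : ℕ} (bc : BC) (a : ℝ) (v : Space d → ℝ) (y : Space d) : ℝ :=
  match bc with
  | .per => ∑' n : Fin d → ℤ, v (y + latticePoint (2 * a) n)
  | .zero => v y
  | .par => v y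

/-! ### The loop soup and its Gibbs transform -/

/-- Points of `ℝ^d` with a path as a mark. -/
abbrev MarkedPoint (d : ℕ) (β : ℝ≥0) : Type := Space d × Path d β

/-- The intensity measure `ν(dx, df) = ∑_{k ≥ 1} (1/k) dx ⊗ μ^{(k,Λ,bc)}_{x,x}(df)`, with `x` in
`Λ = [-a, a]^d`. -/
def intensity {d : ℕ} (W : MeasureTheory.Measure C(ℝ≥0, Space d)) (β : ℝ≥0) (bc : BC) (a : ℝ) :
    MeasureTheory.Measure (MarkedPoint d β) :=
  MeasureTheory.Measure.sum fun k : ℕ+ => ((k : ℕ) : ℝ≥0∞)⁻¹ •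
    (MeasureTheory.volume.restrict (cube (0 : Space d) a)).bind fun x =>
      (bcBridgeMeasure W β bc a k x x).map
        (fun f => ((x, ⟨(k : ℕ), f⟩) : MarkedPoint d β))

/-- Finite configurations `ω = ∑_p δ_{z p}`, with the points listed as `z : Fin n → X`. All
functionals of configurations below are invariant under relabelling. -/
abbrev Config (X : Type*) : Type _ := Σ n : ℕ, Fin n → X

/-- The measure `∑_n (1/n!) ν^{⊗ n}` on finite configurations, which is `e^{ν(X)}` times the
law of the Poisson point process with intensity measure `ν`, if `ν` is finite. -/
def poissonWeight {X : Type*} [MeasurableSpace X] (ν : MeasureTheory.Measure X) :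
    MeasureTheory.Measure (Config X) :=
  MeasureTheory.Measure.sum fun n : ℕ => ((n.factorial : ℕ) : ℝ≥0∞)⁻¹ •
    (MeasureTheory.Measure.pi fun _ : Fin n => ν).map (Sigma.mk n)

/-- The law of the Poisson point process with finite intensity measure `ν`: the number of points is
Poisson distributed with parameter `ν(X)`, and given their number the points are independent with
law `ν / ν(X)`. -/
def poissonLaw {X : Type*} [MeasurableSpace X] (ν : MeasureTheory.Measure X) :
    MeasureTheory.Measure (Config X) :=
  ENNReal.ofReal (Real.exp (-(ν Set.univ).toReal)) • poissonWeight ν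

/-- `V(f_i, g_j) = ∫_0^β v(f_i(s) - g_j(s)) ds`, the interaction between the leg `f_i` of `f` that
starts at time `i β` and the leg `g_j` of `g` that starts at time `j β`. -/
def legInteraction {d : ℕ} {β : ℝ≥0} (v : Space d → ℝ) (f g : Path d β) (i j : ℕ) : ℝ :=
  ∫ s in (0 : ℝ)..β, v (f.eval (i * β + s) - g.eval (j * β + s))

/-- The interaction `Φ_{Λ,Λ}(ω)`: one half of the sum of the interactions over all ordered pairs of
different legs `(p, i) ≠ (q, j)` of the configuration. -/
def interaction {d : ℕ} {β : ℝ≥0} (v : Space d → ℝ) (ω : Config (MarkedPoint d β)) : ℝ :=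
  ∑ p, ∑ q, (1 / 2 : ℝ) *
    ∑ i ∈ Finset.range (ω.2 p).2.1, ∑ j ∈ Finset.range (ω.2 q).2.1,
      if (p, i) ≠ (q, j) then legInteraction v (ω.2 p).2 (ω.2 q).2 i j else 0

/-- The Boltzmann factor `e^{-Φ}`. -/
def boltzmann {d : ℕ} {β : ℝ≥0} (v : Space d → ℝ) (ω : Config (MarkedPoint d β)) : ℝ≥0∞ :=
  ENNReal.ofReal (Real.exp (-interaction v ω))

/-- The normalised measure `H dM / ∫ H dM`. -/
def tilted {Y : Type*} [MeasurableSpace Y] (M : MeasureTheory.Measure Y) (H : Y → ℝ≥0∞) :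
    MeasureTheory.Measure Y :=
  (∫⁻ y, H y ∂M)⁻¹ • M.withDensity H

/-- The total mass of `∑_n (1/n!) ν^{⊗ n}` is `e^{ν(X)}`, so that `poissonLaw ν` is a probability
measure. -/
theorem poissonLaw_univ {X : Type*} [MeasurableSpace X] (ν : MeasureTheory.Measure X)
    [MeasureTheory.IsFiniteMeasure ν] : poissonLaw ν Set.univ = 1 := by
  have hm : ν Set.univ ≠ ∞ := MeasureTheory.measure_ne_top ν _
  set m : ℝ := (ν Set.univ).toReal with hm_def
  have hm0 : 0 ≤ m := ENNReal.toReal_nonneg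
  have hν : ν Set.univ = ENNReal.ofReal m := (ENNReal.ofReal_toReal hm).symm
  have hsum : HasSum (fun n : ℕ => m ^ n / (n.factorial : ℝ)) (Real.exp m) := by
    rw [Real.exp_eq_exp_ℝ]
    exact NormedSpace.expSeries_div_hasSum_exp m
  have key : poissonWeight ν Set.univ = ENNReal.ofReal (Real.exp m) := by
    unfold poissonWeight
    rw [MeasureTheory.Measure.sum_apply _ MeasurableSet.univ, ← hsum.tsum_eq,
      ENNReal.ofReal_tsum_of_nonneg (fun n => by positivity) hsum.summable]
    refine tsum_congr fun n => ?_
    rw [MeasureTheory.Measure.smul_apply, smul_eq_mul, MeasureTheory.Measure.map_apply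
      (measurable_iff_le_map.2 (iInf_le _ n)) MeasurableSet.univ, Set.preimage_univ, MeasureTheory.Measure.pi_univ]
    simp only [Finset.prod_const, Finset.card_univ, Fintype.card_fin]
    rw [hν, ← ENNReal.ofReal_pow hm0, ENNReal.ofReal_div_of_pos (by positivity),
      ENNReal.ofReal_natCast, ENNReal.div_eq_inv_mul]
  rw [poissonLaw, MeasureTheory.Measure.smul_apply, smul_eq_mul, key,
    ← ENNReal.ofReal_mul (Real.exp_pos _).le, ← Real.exp_add, ← hm_def]
  simp

/-- For a finite intensity measure, tilting the Poisson law and tilting `∑_n (1/n!) ν^{⊗ n}` is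
the same, since the constant `e^{-ν(X)}` cancels. -/
theorem tilted_poissonLaw {X : Type*} [MeasurableSpace X] (ν : MeasureTheory.Measure X)
    (H : Config X → ℝ≥0∞) : tilted (poissonLaw ν) H = tilted (poissonWeight ν) H := by
  set c : ℝ≥0∞ := ENNReal.ofReal (Real.exp (-(ν Set.univ).toReal)) with hc
  have hc0 : c ≠ 0 := by simp [hc, Real.exp_pos]
  have hct : c ≠ ∞ := ENNReal.ofReal_ne_top
  unfold tilted poissonLaw
  rw [← hc, MeasureTheory.lintegral_smul_measure, MeasureTheory.withDensity_smul_measure,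
    smul_smul, smul_eq_mul, ENNReal.mul_inv (Or.inl hc0) (Or.inl hct), mul_comm c⁻¹, mul_assoc,
    ENNReal.inv_mul_cancel hc0 hct, mul_one]

/-- The transformed measure `dQ̂ = e^{-Φ} dQ / Q[e^{-Φ}]`, where `Q` is the Poisson point process
with intensity measure `ν = intensity W β bc a`. For zero and particle boundary conditions, `ν` is
finite, and this is literally `tilted (poissonLaw ν) e^{-Φ}`, see `tilted_poissonLaw`. For periodic
boundary conditions, `ν` has infinite total mass because of the very long loops, but
`∑_n (1/n!) ∫ e^{-Φ} dν^{⊗ n}` is finite for superstable `v`; the definition is then the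
limit as `K → ∞` of the measures for the intensity measure restricted to loops of length at most
`K`. -/
def transformedLaw {d : ℕ} (W : MeasureTheory.Measure C(ℝ≥0, Space d)) (β : ℝ≥0)
    (v : Space d → ℝ) (bc : BC) (a : ℝ) : MeasureTheory.Measure (Config (MarkedPoint d β)) :=
  tilted (poissonWeight (intensity W β bc a)) (boltzmann (bcPotential bc a v))

/-! ### Particle numbers -/

/-- All the particles `f(0), f(β), …, f((ℓ(f) - 1) β)` of `f` lie in one of the subboxes
`z + [-r, r]^d`, `z ∈ 2 r ℤ^d`. -/
def NonCrossing {d : ℕ} {β : ℝ≥0} (bc : BC) (a r : ℝ) (f : Path d β) : Prop :=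
  ∃ n : Fin d → ℤ, ∀ l < f.1,
    position bc a (f.eval (l * β)) ∈ cube (latticePoint (2 * r) n) r

open Classical in
/-- The number of particles in crossing loops of length `≤ L`. (All points of the configuration are
in `Λ`.) -/
def particlesCrossingLe {d : ℕ} {β : ℝ≥0} (bc : BC) (a r : ℝ) (L : ℕ)
    (ω : Config (MarkedPoint d β)) : ℕ :=
  ∑ p, if ¬ NonCrossing bc a r (ω.2 p).2 ∧ (ω.2 p).2.1 ≤ L then (ω.2 p).2.1 else 0

open Classical in
/-- The number of particles in noncrossing loops of length `> L`. -/
def particlesNonCrossingGt {d : ℕ} {β : ℝ≥0} (bc : BC) (a r : ℝ) (L : ℕ)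
    (ω : Config (MarkedPoint d β)) : ℕ :=
  ∑ p, if NonCrossing bc a r (ω.2 p).2 ∧ L < (ω.2 p).2.1 then (ω.2 p).2.1 else 0

end

end BoseLoops

namespace BoseLoops

open MeasureTheory ProbabilityTheory

/-! ### Poisson weights -/

section Poisson

variable {X : Type*} [MeasurableSpace X]

/-! Both estimates are exponential Chebyshev bounds for an additive functional `M(ω) = ∑ m(f)` of
the loops. Since `v ≥ 0`, the interaction between different loops can be dropped, so the Boltzmann
factor is at most a product of factors `exp(-selfEnergy)`. The empty configuration alone makes the
partition function at least `1`. The exponential formula for Poisson weights then gives `Q(M > c) ≤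
exp(-θ c + ∫ exp(θ m - selfEnergy) dν)` (`tilted_poissonWeight_le`). It suffices to bound the
integral by `C₁ |Λ| + C₂(θ)` with `C₁` independent of `θ`. Then `N → ∞` removes `C₂`, and `θ → ∞`
with `R` sends the rate `-θ ε + C₁` to `-∞` (`limsup_log_eq_bot`).

The integral is controlled by writing `exp(θ m - selfEnergy) ≤ 1 + X`, where `X` has integral at
most of the order of that of `1`, uniformly in `θ` (`exists_transformedLaw_le`). On the torus the
constant `1` is not integrable over very long loops. For lengths at least `K |Λ|`, superstability in
`Λ` itself gives energy at least `(θ + 1) k`, which leaves the summable factor `exp(-k)`.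

A noncrossing loop of length `k` keeps its `k` particles in one subbox. At an intermediate time `s`
its legs may leave the subbox, but most stay within distance `D` unless the total displacement is
large. If the average displacement over `s` is at most `D k / 4`, superstability in the enlarged
subbox gives an energy of order `k²`, which beats `θ k` for `k > L`. Otherwise the exponential
moment of the displacement, which grows at most like `A ^ k`, is beaten by `exp(-D k / 4)` for large
`D` (`exp_sub_selfEnergy_le`, `lintegral_exp_displacement_le`).

A crossing loop starts within `D` of a face of a subbox, a fraction at most `d D / r` of the volume,
or has total displacement at least `D`. With `θ = L` the tilt costs at most `exp(L²)` on loops of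
length at most `L`. Taking `D = √R`, this cost is compensated if `L = L_R` grows slowly enough with
`R` (`exists_slow_seq`). -/

theorem lintegral_pi_prod (ν : Measure X) [SigmaFinite ν] {h : X → ℝ≥0∞} (hh : Measurable h)
    (n : ℕ) : ∫⁻ z, ∏ i : Fin n, h (z i) ∂Measure.pi (fun _ : Fin n => ν) = (∫⁻ x, h x ∂ν) ^ n := by
  induction n with
  | zero => simp
  | succ n ih =>
    rw [← ((measurePreserving_piFinSuccAbove (fun _ : Fin (n + 1) => ν) 0).symm).lintegral_comp_emb
      (MeasurableEquiv.measurableEmbedding _)]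
    simp only [MeasurableEquiv.piFinSuccAbove_symm_apply, Fin.insertNthEquiv_zero,
      Fin.consEquiv_apply, Fin.prod_univ_succ, Fin.cons_zero, Fin.cons_succ]
    rw [lintegral_prod_mul (f := h) (g := fun z : Fin n → X => ∏ i, h (z i)) hh.aemeasurable
      (Finset.measurable_prod _ fun i _ => hh.comp (measurable_pi_apply i)).aemeasurable, ih,
      pow_succ']

theorem measurable_sigmaMk {ι : Type*} {Y : ι → Type*} [∀ i, MeasurableSpace (Y i)] (i : ι) :
    Measurable (Sigma.mk i : Y i → Sigma Y) :=
  measurable_iff_le_map.2 (iInf_le _ i)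

theorem measurable_sigma_of {ι β : Type*} {Y : ι → Type*} [∀ i, MeasurableSpace (Y i)]
    [MeasurableSpace β] {f : Sigma Y → β} (hf : ∀ i, Measurable fun y => f ⟨i, y⟩) :
    Measurable f := fun s hs => by
  rw [MeasurableSpace.measurableSet_iInf]
  exact fun i => hf i hs

theorem measurable_prod_points {h : X → ℝ≥0∞} (hh : Measurable h) :
    Measurable fun ω : Config X => ∏ p, h (ω.2 p) :=
  measurable_sigma_of fun n => by
    change Measurable fun z : Fin n → X => ∏ p, h (z p)
    exact Finset.measurable_prod _ fun i _ => hh.comp (measurable_pi_apply i)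

theorem lintegral_poissonWeight_prod (ν : Measure X) [SigmaFinite ν] {h : X → ℝ≥0∞}
    (hh : Measurable h) :
    ∫⁻ ω, ∏ p, h (ω.2 p) ∂poissonWeight ν
      = ∑' n : ℕ, ((n.factorial : ℕ) : ℝ≥0∞)⁻¹ * (∫⁻ x, h x ∂ν) ^ n := by
  unfold poissonWeight
  rw [lintegral_sum_measure]
  refine tsum_congr fun n => ?_
  rw [lintegral_smul_measure, lintegral_map (measurable_prod_points hh) (measurable_sigmaMk n),
    smul_eq_mul]
  congr 1
  exact lintegral_pi_prod ν hh n

theorem lintegral_poissonWeight_prod_le (ν : Measure X) [SigmaFinite ν] {h : X → ℝ≥0∞}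
    (hh : Measurable h) {b : ℝ} (hb : 0 ≤ b) (hν : ∫⁻ x, h x ∂ν ≤ ENNReal.ofReal b) :
    ∫⁻ ω, ∏ p, h (ω.2 p) ∂poissonWeight ν ≤ ENNReal.ofReal (Real.exp b) := by
  have hsum : HasSum (fun n : ℕ => b ^ n / (n.factorial : ℝ)) (Real.exp b) := by
    rw [Real.exp_eq_exp_ℝ]
    exact NormedSpace.expSeries_div_hasSum_exp b
  rw [lintegral_poissonWeight_prod ν hh, ← hsum.tsum_eq,
    ENNReal.ofReal_tsum_of_nonneg (fun n => by positivity) hsum.summable]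
  refine ENNReal.tsum_le_tsum fun n => ?_
  rw [ENNReal.ofReal_div_of_pos (by positivity), ENNReal.ofReal_natCast, ENNReal.div_eq_inv_mul,
    ENNReal.ofReal_pow hb]
  gcongr

/-- Allows `withDensity_apply'` on events that are not known to be measurable. -/
instance poissonWeight_sFinite (ν : Measure X) [SigmaFinite ν] : SFinite (poissonWeight ν) := by
  unfold poissonWeight
  infer_instance

/-- The empty configuration has weight `1`. As `H` need not be measurable, it is compared with the
indicator of the empty configurations before the pushforward is evaluated. -/
theorem one_le_lintegral_poissonWeight (ν : Measure X) {H : Config X → ℝ≥0∞}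
    (hH : ∀ z : Fin 0 → X, 1 ≤ H ⟨0, z⟩) : 1 ≤ ∫⁻ ω, H ω ∂poissonWeight ν := by
  unfold poissonWeight
  rw [lintegral_sum_measure]
  refine le_trans ?_ (ENNReal.le_tsum 0)
  have hms : MeasurableSet {ω : Config X | ω.1 = 0} :=
    measurable_sigma_of (f := fun ω : Config X => ω.1) (fun _ => measurable_const)
      (measurableSet_singleton 0)
  rw [lintegral_smul_measure]
  calc (1 : ℝ≥0∞) = ((Nat.factorial 0 : ℕ) : ℝ≥0∞)⁻¹ • ∫⁻ ω, Set.indicator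
        {ω : Config X | ω.1 = 0} (fun _ => 1) ω
        ∂((Measure.pi fun _ : Fin 0 => ν).map (Sigma.mk 0)) := by
        rw [lintegral_indicator_const hms, Measure.map_apply (measurable_sigmaMk 0) hms]
        have : Sigma.mk 0 ⁻¹' {ω : Config X | ω.1 = 0} = Set.univ := by ext; simp
        rw [this]
        simp
    _ ≤ _ := by
        gcongr with ω
        refine Set.indicator_le (fun ω hω => ?_) ω
        obtain ⟨n, z⟩ := ω
        obtain rfl : n = 0 := hω
        exact hH z

/-- Exponential Chebyshev inequality: on the event, `1 ≤ exp(θ (∑ m - c))`, and the resulting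
product over the points integrates to an exponential. The function `h` serves as a measurable
majorant, so `m`, `self` and `H` need no measurability. -/
theorem tilted_poissonWeight_le (ν : Measure X) [SigmaFinite ν] {H : Config X → ℝ≥0∞}
    (hH0 : ∀ z : Fin 0 → X, 1 ≤ H ⟨0, z⟩) (m : X → ℕ) (self : X → ℝ)
    (hH : ∀ ω : Config X, H ω ≤ ENNReal.ofReal (Real.exp (- ∑ p, self (ω.2 p))))
    {θ : ℝ} (hθ : 0 ≤ θ) {h : X → ℝ≥0∞} (hh : Measurable h)
    (hle : ∀ x, ENNReal.ofReal (Real.exp (θ * m x - self x)) ≤ h x)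
    {b : ℝ} (hb : 0 ≤ b) (hν : ∫⁻ x, h x ∂ν ≤ ENNReal.ofReal b) (c : ℝ) :
    tilted (poissonWeight ν) H {ω | c < ((∑ p, m (ω.2 p) : ℕ) : ℝ)}
      ≤ ENNReal.ofReal (Real.exp (-(θ * c) + b)) := by
  unfold tilted
  rw [Measure.smul_apply, smul_eq_mul, withDensity_apply']
  have h1 := one_le_lintegral_poissonWeight ν hH0
  calc _ ≤ 1 * ∫⁻ ω in {ω : Config X | c < ((∑ p, m (ω.2 p) : ℕ) : ℝ)}, H ω ∂poissonWeight ν := by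
        gcongr
        exact ENNReal.inv_le_one.2 h1
    _ ≤ ∫⁻ ω in {ω : Config X | c < ((∑ p, m (ω.2 p) : ℕ) : ℝ)},
          ENNReal.ofReal (Real.exp (-(θ * c))) * ∏ p, h (ω.2 p) ∂poissonWeight ν := by
        rw [one_mul]
        refine setLIntegral_mono (measurable_const.mul (measurable_prod_points hh)) fun ω hω => ?_
        refine (hH ω).trans ?_
        calc ENNReal.ofReal (Real.exp (- ∑ p, self (ω.2 p)))
            ≤ ENNReal.ofReal (Real.exp (-(θ * c)) *
                ∏ p, Real.exp (θ * m (ω.2 p) - self (ω.2 p))) := by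
              apply ENNReal.ofReal_le_ofReal
              rw [← Real.exp_sum, ← Real.exp_add]
              apply Real.exp_le_exp.2
              rw [Finset.sum_sub_distrib, ← Finset.mul_sum]
              have : θ * c ≤ θ * ((∑ p, m (ω.2 p) : ℕ) : ℝ) :=
                mul_le_mul_of_nonneg_left (le_of_lt hω) hθ
              push_cast at this
              linarith
          _ ≤ _ := by
              rw [ENNReal.ofReal_mul (Real.exp_pos _).le,
                ENNReal.ofReal_prod_of_nonneg fun _ _ => (Real.exp_pos _).le]
              gcongr
              exact hle _
    _ ≤ ∫⁻ ω, ENNReal.ofReal (Real.exp (-(θ * c))) * ∏ p, h (ω.2 p) ∂poissonWeight ν :=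
        setLIntegral_le_lintegral _ _
    _ ≤ _ := by
        rw [lintegral_const_mul _ (measurable_prod_points hh), Real.exp_add,
          ENNReal.ofReal_mul (Real.exp_pos _).le]
        gcongr
        exact lintegral_poissonWeight_prod_le ν hh hb hν

end Poisson

/-! ### Gaussian lattice sums -/

section Lattice

theorem tsum_pi_prod {d : ℕ} (f : ℤ → ℝ≥0∞) :
    ∑' n : Fin d → ℤ, ∏ c, f (n c) = (∑' m, f m) ^ d := by
  induction d with
  | zero => simp
  | succ d ih =>
    rw [← (Fin.consEquiv fun _ : Fin (d + 1) => ℤ).tsum_eq, ENNReal.tsum_prod']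
    simp only [Fin.consEquiv_apply, Fin.prod_univ_succ, Fin.cons_zero, Fin.cons_succ,
      ENNReal.tsum_mul_left, ih, ENNReal.tsum_mul_right, pow_succ']

theorem sum_exp_neg_mul_sq_le {q : ℝ} (hq : 0 < q) (n : ℕ) :
    ∑ i ∈ Finset.range n, Real.exp (-q * ((i : ℝ) + 1) ^ 2) ≤ √(Real.pi / q) / 2 := by
  have hanti : AntitoneOn (fun x : ℝ => Real.exp (-q * x ^ 2)) (Set.Icc (0 : ℝ) (0 + n)) := by
    intro x hx y hy hxy
    apply Real.exp_le_exp.2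
    have := hx.1
    nlinarith [mul_le_mul_of_nonneg_left (pow_le_pow_left₀ hx.1 hxy 2) hq.le]
  have h := hanti.sum_le_integral
  simp only [zero_add, Nat.cast_add, Nat.cast_one] at h
  refine h.trans ?_
  rw [← integral_gaussian_Ioi q, intervalIntegral.integral_of_le (by positivity)]
  exact MeasureTheory.setIntegral_mono_set (integrable_exp_neg_mul_sq hq).integrableOn
    (Filter.Eventually.of_forall fun x => (Real.exp_pos _).le)
    (Filter.Eventually.of_forall fun x hx => hx.1)

/-- The term `m = 0` is `1`, and by monotonicity each half-line contributes at most half of the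
Gaussian integral. -/
theorem tsum_exp_neg_mul_sq_le {q : ℝ} (hq : 0 < q) :
    ∑' m : ℤ, ENNReal.ofReal (Real.exp (-q * (m : ℝ) ^ 2))
      ≤ ENNReal.ofReal (1 + √(Real.pi / q)) := by
  have key : ∑' n : ℕ, ENNReal.ofReal (Real.exp (-q * ((n : ℝ) + 1) ^ 2))
      ≤ ENNReal.ofReal (√(Real.pi / q) / 2) := by
    rw [ENNReal.tsum_eq_iSup_nat]
    refine iSup_le fun n => ?_
    rw [← ENNReal.ofReal_sum_of_nonneg fun _ _ => (Real.exp_pos _).le]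
    exact ENNReal.ofReal_le_ofReal (sum_exp_neg_mul_sq_le hq n)
  rw [tsum_of_add_one_of_neg_add_one ENNReal.summable ENNReal.summable]
  push_cast
  simp only [even_two.neg_pow]
  calc _ ≤ ENNReal.ofReal (√(Real.pi / q) / 2) + ENNReal.ofReal (Real.exp (-q * 0 ^ 2))
        + ENNReal.ofReal (√(Real.pi / q) / 2) := by
        gcongr
    _ = _ := by
        rw [← ENNReal.ofReal_add (by positivity) (by positivity),
          ← ENNReal.ofReal_add (by positivity) (by positivity)]
        congr 1
        simp; ring

end Lattice

/-! ### Exponential moments of Brownian increments -/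

section Moments

variable {Ω : Type*} [MeasurableSpace Ω] {P : Measure Ω}

/-- Each summand is at most the largest one. This separates exponential moments of a sum without any
independence of the summands. -/
theorem exp_sum_le_sum_exp {ι : Type*} (s : Finset ι) (hs : s.Nonempty) (p : ι → ℝ) :
    Real.exp (∑ i ∈ s, p i) ≤ ∑ i ∈ s, Real.exp (s.card * p i) := by
  obtain ⟨j, hj, hmax⟩ := s.exists_max_image p hs
  calc Real.exp (∑ i ∈ s, p i) ≤ Real.exp (s.card * p j) := by
        apply Real.exp_le_exp.2
        rw [← nsmul_eq_mul]
        exact Finset.sum_le_card_nsmul _ _ _ hmax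
    _ ≤ _ := Finset.single_le_sum (f := fun i => Real.exp (s.card * p i))
        (fun i _ => (Real.exp_pos _).le) hj

theorem lintegral_exp_abs_le {Y : Ω → ℝ} {σ : ℝ≥0} (hY : HasLaw Y (gaussianReal 0 σ) P)
    (κ : ℝ) :
    ∫⁻ ω, ENNReal.ofReal (Real.exp (κ * |Y ω|)) ∂P
      ≤ ENNReal.ofReal (2 * Real.exp (κ ^ 2 * σ / 2)) := by
  have key : ∀ t : ℝ, ∫⁻ ω, ENNReal.ofReal (Real.exp (t * Y ω)) ∂P
      = ENNReal.ofReal (Real.exp (t ^ 2 * σ / 2)) := fun t => by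
    have hmgf := mgf_gaussianReal hY.map_eq t
    have hint : Integrable (fun ω => Real.exp (t * Y ω)) P := by
      rw [mgf] at hmgf
      by_contra hni
      rw [integral_undef hni] at hmgf
      exact (Real.exp_pos _).ne hmgf
    rw [← ofReal_integral_eq_lintegral_ofReal hint
      (Filter.Eventually.of_forall fun _ => (Real.exp_pos _).le)]
    rw [mgf] at hmgf
    rw [hmgf]
    congr 2; ring
  calc _ ≤ ∫⁻ ω, (ENNReal.ofReal (Real.exp (κ * Y ω))
        + ENNReal.ofReal (Real.exp (-κ * Y ω))) ∂P := by
        gcongr with ω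
        rcases abs_cases (Y ω) with ⟨h, _⟩ | ⟨h, _⟩
        · rw [h]; exact le_self_add
        · rw [h, mul_neg, ← neg_mul]; exact le_add_self
    _ = _ := by
        rw [lintegral_add_left', key, key, neg_sq, ← ENNReal.ofReal_add (Real.exp_pos _).le
          (Real.exp_pos _).le]
        · congr 1; ring
        · exact (Real.measurable_exp.comp_aemeasurable
            (hY.aemeasurable.const_mul κ)).ennreal_ofReal

theorem lintegral_exp_sum_abs_increments_le {B : ℝ≥0 → Ω → ℝ} (hB : IsPreBrownianReal B P)
    (hm : ∀ t, Measurable (B t)) {s β : ℝ≥0} (hs : s ≤ β) (κ : ℝ) (k : ℕ) :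
    ∫⁻ ω, ENNReal.ofReal (Real.exp (κ * ∑ i ∈ Finset.range k, |B (i * β + s) ω - B (i * β) ω|)) ∂P
      ≤ ENNReal.ofReal ((2 * Real.exp (κ ^ 2 * β / 2)) ^ k) := by
  -- The times `iβ` and `iβ + s` are interleaved into one monotone sequence. The wanted increments
  -- are those with even index, hence independent.
  let t : ℕ → ℝ≥0 := fun j => ((j / 2 : ℕ) : ℝ≥0) * β + if j % 2 = 0 then 0 else s
  have ht : Monotone t := by
    refine monotone_nat_of_le_succ fun j => ?_
    rcases Nat.even_or_odd' j with ⟨i, rfl | rfl⟩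
    · have h1 : 2 * i / 2 = i := by omega
      have h2 : (2 * i + 1) / 2 = i := by omega
      have h3 : (2 * i + 1) % 2 = 1 := by omega
      simp [t, h1, h2, h3]
    · have h1 : (2 * i + 1) / 2 = i := by omega
      have h2 : (2 * i + 1 + 1) / 2 = i + 1 := by omega
      have h3 : (2 * i + 1) % 2 = 1 := by omega
      have h4 : (2 * i + 1 + 1) % 2 = 0 := by omega
      simp only [t, h1, h2, h3, h4]
      simp [add_mul, hs]
  have hind := (hB.hasIndepIncrements.nat ht).precomp
    (g := fun i : ℕ => 2 * i) fun a b h => by simpa using h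
  have heq : ∀ (i : ℕ) ω, B (t (2 * i + 1)) ω - B (t (2 * i)) ω
      = B (i * β + s) ω - B (i * β) ω := fun i ω => by
    have h1 : 2 * i / 2 = i := by omega
    have h2 : (2 * i + 1) / 2 = i := by omega
    have h3 : (2 * i + 1) % 2 = 1 := by omega
    simp [t, h1, h2, h3]
  simp only [heq] at hind
  have hind' := hind.comp (g := fun _ : ℕ => fun x : ℝ => ENNReal.ofReal (Real.exp (κ * |x|)))
    fun i => by fun_prop
  calc _ = ∫⁻ ω, ∏ i ∈ Finset.range k,
        ENNReal.ofReal (Real.exp (κ * |B (i * β + s) ω - B (i * β) ω|)) ∂P := by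
        refine lintegral_congr fun ω => ?_
        rw [Finset.mul_sum, Real.exp_sum, ENNReal.ofReal_prod_of_nonneg fun _ _ =>
          (Real.exp_pos _).le]
    _ = ∏ i ∈ Finset.range k, ∫⁻ ω,
        ENNReal.ofReal (Real.exp (κ * |B (i * β + s) ω - B (i * β) ω|)) ∂P :=
        lintegral_prod_eq_prod_lintegral_of_indepFun (Finset.range k) _ hind' fun i => by
          have h1 := hm (i * β + s)
          have h2 := hm (i * β)
          change Measurable fun ω => ENNReal.ofReal (Real.exp (κ * |B (i * β + s) ω - B (i * β) ω|))
          fun_prop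
    _ ≤ ∏ i ∈ Finset.range k, ENNReal.ofReal (2 * Real.exp (κ ^ 2 * β / 2)) := by
        refine Finset.prod_le_prod' fun i _ => ?_
        refine (lintegral_exp_abs_le (hB.hasLaw_sub (i * β + s) (i * β)) κ).trans ?_
        apply ENNReal.ofReal_le_ofReal
        gcongr
        have : nndist (((i : ℝ≥0) * β + s : ℝ≥0)).1 ((i : ℝ≥0) * β).1 = s := by
          ext
          simp
        rw [this]
        exact hs
    _ = _ := by rw [Finset.prod_const, Finset.card_range, ENNReal.ofReal_pow (by positivity)]

end Moments

/-! ### Exponential moments of the displacements in a bridge -/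

section Bridge

variable {d : ℕ} {β : ℝ≥0}

/-- The sum over all legs `f_i` of the `ℓ¹` distance between `f_i(s)` and `f_i(0)`. -/
noncomputable def displacement (s : ℝ) (f : Path d β) : ℝ :=
  ∑ i ∈ Finset.range f.1, ∑ c, |f.eval (i * β + s) c - f.eval (i * β) c|

theorem measurable_evalMap {T : Type*} [TopologicalSpace T] (t : T) :
    Measurable fun f : C(T, Space d) => f t :=
  (measurable_pi_apply t).comp (comap_measurable _)

theorem measurable_coordMap {T : Type*} [TopologicalSpace T] (t : T) (c : Fin d) :
    Measurable fun f : C(T, Space d) => f t c :=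
  (show Measurable fun y : Space d => y c by fun_prop).comp (measurable_evalMap t)

theorem measurable_toPathSpace {Y T : Type*} [MeasurableSpace Y] [TopologicalSpace T]
    {g : Y → C(T, Space d)} (hg : ∀ t c, Measurable fun y => g y t c) : Measurable g := by
  refine measurable_comap_iff.2 (measurable_pi_iff.2 fun t => ?_)
  exact (WithLp.measurable_toLp 2 _).comp (measurable_pi_iff.2 fun c => hg t c)

theorem bridgePath_apply (T : ℝ≥0) (x y : Space d) (w : C(ℝ≥0, Space d)) (t : Set.Iic T)
    (c : Fin d) : bridgePath T x y w t c
      = x c + ((t : ℝ≥0) / T : ℝ) * (y c - x c) + √2 * (w t c - ((t : ℝ≥0) / T : ℝ) * w T c) := by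
  simp [bridgePath]

theorem measurable_bridgePath (T : ℝ≥0) (x y : Space d) : Measurable (bridgePath T x y) := by
  refine measurable_toPathSpace (T := Set.Iic T) fun t c => ?_
  have h1 := measurable_coordMap (d := d) (t : ℝ≥0) c
  have h2 := measurable_coordMap (d := d) T c
  have h3 := (measurable_const (a := x c + ((t : ℝ≥0) / T : ℝ) * (y c - x c))).add
    ((h1.sub (h2.const_mul ((t : ℝ≥0) / T : ℝ))).const_mul √2)
  have h4 : (fun w => bridgePath T x y w t c) = _ := funext fun w => bridgePath_apply T x y w t c
  rw [h4]
  exact h3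

theorem continuous_eval (f : Path d β) : Continuous fun t : ℝ => f.eval t := by
  unfold Path.eval
  fun_prop

theorem continuous_eval_coord (f : Path d β) (c : Fin d) : Continuous fun t : ℝ => f.eval t c :=
  (show Continuous fun y : Space d => y c by fun_prop).comp (continuous_eval f)

theorem continuous_displacement (f : Path d β) : Continuous fun s => displacement s f := by
  unfold displacement
  refine continuous_finsetSum _ fun i _ => continuous_finsetSum _ fun c _ => ?_
  have h1 := (continuous_eval_coord f c).comp (show Continuous fun s : ℝ => (i : ℝ) * β + s by fun_prop)
  exact (h1.sub continuous_const).abs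

theorem measurable_eval_coord (k : ℕ) (t : ℝ) (c : Fin d) :
    Measurable fun f : PathSpace d β k => Path.eval ⟨k, f⟩ t c :=
  measurable_coordMap (T := Set.Iic ((k : ℝ≥0) * β)) (d := d)
    ⟨min t.toNNReal ((k : ℝ≥0) * β), Set.mem_Iic.2 (min_le_right _ _)⟩ c

theorem measurable_displacement (k : ℕ) (s : ℝ) :
    Measurable fun f : PathSpace d β k => displacement s ⟨k, f⟩ := by
  change Measurable fun f : PathSpace d β k => ∑ i ∈ Finset.range k, ∑ c,
    |Path.eval ⟨k, f⟩ (i * β + s) c - Path.eval ⟨k, f⟩ (i * β) c|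
  refine Finset.measurable_fun_sum _ fun i _ => Finset.measurable_fun_sum _ fun c _ => ?_
  have h1 := measurable_eval_coord (d := d) (β := β) k (i * β + s) c
  have h2 := measurable_eval_coord (d := d) (β := β) k (i * β) c
  exact (h1.sub h2).abs

theorem measurable_displacement_uncurry (k : ℕ) :
    Measurable fun p : ℝ × PathSpace d β k => displacement p.1 ⟨k, p.2⟩ :=
  measurable_uncurry_of_continuous_of_measurable
    (u := fun (s : ℝ) (f : PathSpace d β k) => displacement s ⟨k, f⟩)
    (fun f => continuous_displacement ⟨k, f⟩) fun s => measurable_displacement k s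

theorem eval_of_le {k : ℕ} (f : PathSpace d β k) {t : ℝ≥0} (ht : t ≤ k * β) :
    Path.eval ⟨k, f⟩ (t : ℝ) = f ⟨t, ht⟩ := by
  simp only [Path.eval, Real.toNNReal_coe, min_eq_left ht]

/-- The pinning correction of the bridge is linear in time, so a leg sees at most the fraction `s /
(kβ) ≤ 1 / k` of it; summed over `k` legs, it enters once. -/
theorem displacement_bridgePath_le {k : ℕ} (hk : 1 ≤ k) (hβ : 0 < β) {s : ℝ≥0} (hs : s ≤ β)
    (x y : Space d) (w : C(ℝ≥0, Space d)) :
    displacement (s : ℝ) (⟨k, bridgePath (k * β) x y w⟩ : Path d β)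
      ≤ ∑ c, |y c - x c| + ∑ c, (√2 * ∑ i ∈ Finset.range k, |w (i * β + s) c - w (i * β) c|
          + √2 * |w (k * β) c|) := by
  have hβ' : (0 : ℝ) < β := hβ
  have hk' : (0 : ℝ) < k := by positivity
  have hsβ : (s : ℝ) ≤ β := hs
  have hs0 : (0 : ℝ) ≤ s := s.2
  unfold displacement
  rw [Finset.sum_comm, ← Finset.sum_add_distrib]
  refine Finset.sum_le_sum fun c _ => ?_
  have hterm : ∀ i ∈ Finset.range k,
      |Path.eval (⟨k, bridgePath (k * β) x y w⟩ : Path d β) (i * β + s) c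
        - Path.eval (⟨k, bridgePath (k * β) x y w⟩ : Path d β) (i * β) c|
      ≤ √2 * |w (i * β + s) c - w (i * β) c| + (1 / k) * (|y c - x c| + √2 * |w (k * β) c|) := by
    intro i hi
    have hi' : i + 1 ≤ k := Finset.mem_range.1 hi
    have h2 : (i : ℝ≥0) * β + s ≤ k * β := by
      calc (i : ℝ≥0) * β + s ≤ (i : ℝ≥0) * β + β := by gcongr
        _ = ((i + 1 : ℕ) : ℝ≥0) * β := by push_cast; ring
        _ ≤ k * β := by gcongr
    have h1 : (i : ℝ≥0) * β ≤ k * β := le_trans le_self_add h2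
    have e1 := eval_of_le (bridgePath (k * β) x y w) h1
    have e2 := eval_of_le (bridgePath (k * β) x y w) h2
    push_cast at e1 e2
    rw [e1, e2, bridgePath_apply, bridgePath_apply]
    push_cast
    have hfrac : ((s : ℝ) / (k * β)) ≤ 1 / k := by
      rw [div_le_div_iff₀ (by positivity) hk']
      nlinarith
    have hfrac0 : 0 ≤ (s : ℝ) / (k * β) := by positivity
    calc _ = |√2 * (w (i * β + s) c - w (i * β) c)
          + (s : ℝ) / (k * β) * ((y c - x c) - √2 * w (k * β) c)| := by
          congr 1; field_simp; ring
      _ ≤ √2 * |w (i * β + s) c - w (i * β) c|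
          + (s : ℝ) / (k * β) * (|y c - x c| + √2 * |w (k * β) c|) := by
          refine (abs_add_le _ _).trans ?_
          rw [abs_mul, abs_mul, abs_of_nonneg (Real.sqrt_nonneg 2), abs_of_nonneg hfrac0]
          gcongr
          refine (abs_sub _ _).trans ?_
          rw [abs_mul, abs_of_nonneg (Real.sqrt_nonneg 2)]
      _ ≤ _ := by gcongr
  refine (Finset.sum_le_sum hterm).trans (le_of_eq ?_)
  rw [Finset.sum_add_distrib, Finset.sum_const, Finset.card_range, nsmul_eq_mul, ← Finset.mul_sum]
  have : (k : ℝ) * (1 / k) = 1 := by field_simp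
  linear_combination (|y c - x c| + √2 * |w (k * β) c|) * this

theorem lintegral_bridgeMeasure (W : Measure C(ℝ≥0, Space d)) (k : ℕ) (x y : Space d)
    {F : PathSpace d β k → ℝ≥0∞} (hF : Measurable F) :
    ∫⁻ f, F f ∂bridgeMeasure W β k x y = ENNReal.ofReal (heatKernel ((k : ℝ) * β) x y)
      * ∫⁻ w, F (bridgePath ((k : ℝ≥0) * β) x y w) ∂W := by
  rw [bridgeMeasure, lintegral_smul_measure, lintegral_map hF (measurable_bridgePath _ _ _),
    smul_eq_mul]

/-- A bound on the exponential moments of the displacements; the Gaussian in the difference of the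
endpoints is kept at half its exponent. -/
noncomputable def gaussBound (d : ℕ) (β : ℝ≥0) (k : ℕ) (x y : Space d) : ℝ :=
  (4 * Real.pi * (k * β)) ^ (-(d : ℝ) / 2) * Real.exp (-‖x - y‖ ^ 2 / (8 * (k * β)))

/-- Completing the square in each coordinate. The drift from `x` to `y` is thus paid with half of
the Gaussian exponent, and the other half remains for the sum over periodic images. -/
theorem sum_sub_le_sq {k : ℕ} (hk : 1 ≤ k) (hβ : 0 < β) (x y : Space d) :
    ∑ c, |y c - x c| ≤ ‖x - y‖ ^ 2 / (8 * (k * β)) + 2 * d * (k * β) := by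
  have hβ' : (0 : ℝ) < β := hβ
  have hT : (0 : ℝ) < k * β := by positivity
  rw [EuclideanSpace.real_norm_sq_eq, Finset.sum_div]
  have : (2 * d * (k * β) : ℝ) = ∑ c : Fin d, 2 * (k * β : ℝ) := by simp; ring
  rw [this, ← Finset.sum_add_distrib]
  refine Finset.sum_le_sum fun c _ => ?_
  simp only [PiLp.sub_apply]
  rw [← sq_abs, abs_sub_comm (x c)]
  set u := |y c - x c|
  have h : u ^ 2 / (8 * (k * β)) + 2 * (k * β) - u = (u - 4 * (k * β)) ^ 2 / (8 * (k * β)) := by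
    field_simp; ring
  nlinarith [show 0 ≤ (u - 4 * (k * β)) ^ 2 / (8 * (k * β : ℝ)) by positivity]

/-- The growth rate of the exponential moments of the displacements. -/
noncomputable def displacementRate (d : ℕ) (β : ℝ≥0) : ℝ :=
  (2 * d) * (2 * Real.exp ((2 * d * √2) ^ 2 * β / 2)) * Real.exp (2 * d * β)

theorem one_le_displacementRate (hd : 1 ≤ d) : 1 ≤ displacementRate d β := by
  unfold displacementRate
  have h1 : (1 : ℝ) ≤ d := by exact_mod_cast hd
  have h2 : 1 ≤ Real.exp ((2 * d * √2) ^ 2 * β / 2) := Real.one_le_exp (by positivity)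
  have h3 : 1 ≤ Real.exp (2 * d * (β : ℝ)) := Real.one_le_exp (by positivity)
  have h4 : (1 : ℝ) ≤ 2 * d := by linarith
  have h5 : 1 ≤ 2 * Real.exp ((2 * d * √2) ^ 2 * (β : ℝ) / 2) := by linarith
  exact one_le_mul_of_one_le_of_one_le (one_le_mul_of_one_le_of_one_le h4 h5) h3

/-- The displacement is a drift plus `2d` Brownian terms, an increment sum and an endpoint for each
coordinate. These are separated by `exp_sum_le_sum_exp`, and each has exponential moments growing at
most geometrically in `k`. -/
theorem lintegral_exp_displacement_le (hd : 1 ≤ d) {W : Measure C(ℝ≥0, Space d)}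
    (hW : IsWienerMeasure W) (hβ : 0 < β) {k : ℕ} (hk : 1 ≤ k) {s : ℝ} (hs0 : 0 ≤ s) (hs : s ≤ β)
    (x y : Space d) :
    ∫⁻ f, ENNReal.ofReal (Real.exp (displacement s ⟨k, f⟩)) ∂bridgeMeasure W β k x y
      ≤ ENNReal.ofReal (displacementRate d β ^ k * gaussBound d β k x y) := by
  lift s to ℝ≥0 using hs0
  replace hs : s ≤ β := hs
  rw [lintegral_bridgeMeasure W k x y (F := fun f => ENNReal.ofReal (Real.exp
    (displacement s ⟨k, f⟩))) (Real.measurable_exp.comp (measurable_displacement k s)).ennreal_ofReal]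
  have : Nonempty (Fin d) := ⟨⟨0, hd⟩⟩
  have hβ' : (0 : ℝ) < β := hβ
  have hk' : (1 : ℝ) ≤ k := by exact_mod_cast hk
  set κ : ℝ := 2 * d * √2 with hκ
  set Q : ℝ := 2 * Real.exp (κ ^ 2 * β / 2) with hQ
  have hQ1 : 1 ≤ Q := by
    have : 1 ≤ Real.exp (κ ^ 2 * β / 2) := Real.one_le_exp (by positivity)
    linarith
  -- `true` selects the sum of the leg increments, `false` the endpoint. The factor `2d` in `κ` is
  -- the number of these terms.
  set U : Fin d × Bool → C(ℝ≥0, Space d) → ℝ := fun p w =>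
    if p.2 then √2 * ∑ i ∈ Finset.range k, |w (i * β + s) p.1 - w (i * β) p.1|
    else √2 * |w (k * β) p.1| with hU
  have hpt : ∀ w, Real.exp (displacement (s : ℝ) (⟨k, bridgePath (k * β) x y w⟩ : Path d β))
      ≤ Real.exp (∑ c, |y c - x c|) * ∑ p, Real.exp (2 * d * U p w) := by
    intro w
    calc _ ≤ Real.exp (∑ c, |y c - x c| + ∑ p, U p w) := by
          apply Real.exp_le_exp.2
          refine (displacement_bridgePath_le hk hβ hs x y w).trans (le_of_eq ?_)
          rw [Fintype.sum_prod_type]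
          simp [hU]
      _ ≤ _ := by
          rw [Real.exp_add]
          gcongr
          have := exp_sum_le_sum_exp Finset.univ Finset.univ_nonempty fun p => U p w
          simpa [mul_comm] using this
  have hmU : ∀ p, Measurable fun w => ENNReal.ofReal (Real.exp (2 * d * U p w)) := by
    intro p
    refine (Real.measurable_exp.comp (Measurable.const_mul ?_ _)).ennreal_ofReal
    have h1 := fun t => measurable_coordMap (d := d) (T := ℝ≥0) t p.1
    by_cases hp : p.2
    · simp only [hU, hp, if_true]
      exact (Finset.measurable_sum _ fun i _ => ((h1 _).sub (h1 _)).abs).const_mul _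
    · simp only [hU, hp]
      exact ((h1 _).abs).const_mul _
  have hone : ∀ p, ∫⁻ w, ENNReal.ofReal (Real.exp (2 * d * U p w)) ∂W
      ≤ ENNReal.ofReal (Q ^ k) := by
    rintro ⟨c, b⟩
    have hB := (hW.brownian c).toIsPreBrownianReal
    cases b
    · have := lintegral_exp_abs_le (hB.hasLaw_eval (k * β)) κ
      simp only [hU]
      refine le_trans (le_of_eq (lintegral_congr fun w => ?_)) (this.trans
        (ENNReal.ofReal_le_ofReal ?_))
      · simp only [hκ]; congr 2; simp; ring
      · rw [hQ, mul_pow (2 : ℝ), ← Real.exp_nat_mul]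
        gcongr
        · exact le_self_pow₀ (by norm_num) (by omega)
        · apply le_of_eq; push_cast; ring
    · have := lintegral_exp_sum_abs_increments_le hB
        (fun t => measurable_coordMap t c) hs κ k
      simp only [hU]
      refine le_trans (le_of_eq (lintegral_congr fun w => ?_)) this
      simp only [hκ]; congr 2; simp; ring
  have hsum : ∫⁻ w, ENNReal.ofReal (Real.exp (displacement (s : ℝ)
      (⟨k, bridgePath (k * β) x y w⟩ : Path d β))) ∂W
      ≤ ENNReal.ofReal (Real.exp (∑ c, |y c - x c|) * ((2 * d) * Q ^ k)) := by
    calc _ ≤ ∫⁻ w, ENNReal.ofReal (Real.exp (∑ c, |y c - x c|))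
          * ∑ p, ENNReal.ofReal (Real.exp (2 * d * U p w)) ∂W := by
          gcongr with w
          rw [← ENNReal.ofReal_sum_of_nonneg fun _ _ => (Real.exp_pos _).le,
            ← ENNReal.ofReal_mul (Real.exp_pos _).le]
          exact ENNReal.ofReal_le_ofReal (hpt w)
      _ ≤ ENNReal.ofReal (Real.exp (∑ c, |y c - x c|))
          * ∑ p : Fin d × Bool, ENNReal.ofReal (Q ^ k) := by
          rw [lintegral_const_mul _ (Finset.measurable_sum _ fun p _ => hmU p),
            lintegral_finsetSum _ fun p _ => hmU p]
          gcongr with p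
          exact hone p
      _ = _ := by
          rw [Finset.sum_const, Finset.card_univ, ENNReal.ofReal_mul (Real.exp_pos _).le]
          congr 1
          rw [ENNReal.ofReal_mul (by positivity)]
          simp only [Fintype.card_prod, Fintype.card_fin, Fintype.card_bool, nsmul_eq_mul]
          congr 1
          rw [mul_comm d 2, ← ENNReal.ofReal_natCast]
          push_cast
          rfl
  refine (mul_le_mul_right hsum _).trans ?_
  have hhk : 0 ≤ heatKernel ((k : ℝ) * β) x y := by unfold heatKernel; positivity
  rw [← ENNReal.ofReal_mul hhk]
  apply ENNReal.ofReal_le_ofReal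
  have hT : (0 : ℝ) < k * β := by positivity
  have hpow : displacementRate d β ^ k
      = (2 * d) ^ k * Q ^ k * Real.exp (2 * d * (k * β)) := by
    rw [displacementRate, mul_pow, mul_pow, ← Real.exp_nat_mul, ← hκ, ← hQ]
    congr 2; ring
  unfold heatKernel gaussBound
  rw [hpow]
  have hd1 : (2 * d : ℝ) ≤ (2 * d) ^ k :=
    le_self_pow₀ (by have : (1 : ℝ) ≤ d := by exact_mod_cast hd
                     linarith) (by omega)
  have hexp : Real.exp (-‖x - y‖ ^ 2 / (4 * (k * β))) * Real.exp (∑ c, |y c - x c|)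
      ≤ Real.exp (2 * d * (k * β)) * Real.exp (-‖x - y‖ ^ 2 / (8 * (k * β))) := by
    rw [← Real.exp_add, ← Real.exp_add]
    apply Real.exp_le_exp.2
    have h1 := sum_sub_le_sq hk hβ x y
    have h2 : -‖x - y‖ ^ 2 / (4 * (k * β : ℝ))
        = -(‖x - y‖ ^ 2 / (8 * (k * β : ℝ))) - ‖x - y‖ ^ 2 / (8 * (k * β : ℝ)) := by
      field_simp; ring
    have h3 : -‖x - y‖ ^ 2 / (8 * (k * β : ℝ)) = -(‖x - y‖ ^ 2 / (8 * (k * β : ℝ))) := by ring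
    linarith
  calc _ = (4 * Real.pi * (k * β)) ^ (-(d : ℝ) / 2)
        * (Real.exp (-‖x - y‖ ^ 2 / (4 * (k * β))) * Real.exp (∑ c, |y c - x c|))
        * ((2 * d) * Q ^ k) := by ring
    _ ≤ (4 * Real.pi * (k * β)) ^ (-(d : ℝ) / 2)
        * (Real.exp (2 * d * (k * β)) * Real.exp (-‖x - y‖ ^ 2 / (8 * (k * β))))
        * ((2 * d) ^ k * Q ^ k) := by gcongr
    _ = _ := by ring

end Bridge

/-! ### Total masses of the bridge measures in a box -/

section Masses

variable {d : ℕ} {β : ℝ≥0}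

/-- The constant in `kernelBound`. -/
noncomputable def kernelConst (d : ℕ) (β : ℝ≥0) : ℝ :=
  2 ^ (d - 1) * ((√(4 * Real.pi * β))⁻¹ ^ d + √2 ^ d)

open Classical in
/-- A bound on the total mass of the bridge measures of length `k` from a point to itself in the
box `[-a, a]^d`. -/
noncomputable def kernelBound (d : ℕ) (β : ℝ≥0) (bc : BC) (a : ℝ) (k : ℕ) : ℝ :=
  kernelConst d β * ((√(k : ℝ))⁻¹ + if bc = .per then (boxVolume d a)⁻¹ else 0)

theorem kernelConst_nonneg : 0 ≤ kernelConst d β := by unfold kernelConst; positivity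

theorem kernelBound_nonneg {bc : BC} {a : ℝ} (ha : 0 < a) (k : ℕ) :
    0 ≤ kernelBound d β bc a k := by
  unfold kernelBound boxVolume
  have := kernelConst_nonneg (d := d) (β := β)
  split_ifs <;> positivity

theorem rpow_neg_half_eq {T : ℝ} (hT : 0 ≤ T) : T ^ (-(d : ℝ) / 2) = (√T)⁻¹ ^ d := by
  rw [neg_div, Real.rpow_neg hT, inv_pow, Real.sqrt_eq_rpow, ← Real.rpow_natCast,
    ← Real.rpow_mul hT]
  congr 2; ring

/-- Decay like `k^{-1/2}` is enough in every dimension, because the weight `1 / k` of the intensity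
then makes the sum over `k` converge. -/
theorem inv_sqrt_pow_le (hd : 1 ≤ d) {k : ℕ} (hk : 1 ≤ k) :
    (√(4 * Real.pi * (k * β)))⁻¹ ^ d ≤ (√(4 * Real.pi * β))⁻¹ ^ d * (√(k : ℝ))⁻¹ := by
  have h1 : √(4 * Real.pi * (k * β)) = √(4 * Real.pi * β) * √(k : ℝ) := by
    rw [← Real.sqrt_mul (by positivity)]; congr 1; ring
  have hk' : (1 : ℝ) ≤ √(k : ℝ) := Real.one_le_sqrt.2 (by exact_mod_cast hk)
  rw [h1, mul_inv, mul_pow]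
  gcongr
  exact pow_le_of_le_one (by positivity) (inv_le_one_of_one_le₀ hk') (by omega)

theorem gaussBound_self_le (hd : 1 ≤ d) {bc : BC} {a : ℝ} (ha : 0 < a) {k : ℕ} (hk : 1 ≤ k)
    (x : Space d) : gaussBound d β k x x ≤ kernelBound d β bc a k := by
  unfold gaussBound kernelBound kernelConst boxVolume
  rw [rpow_neg_half_eq (by positivity)]
  simp only [sub_self, norm_zero, ne_eq, OfNat.ofNat_ne_zero, not_false_eq_true, zero_pow,
    neg_zero, zero_div, Real.exp_zero, mul_one]
  have h2 : (1 : ℝ) ≤ 2 ^ (d - 1) := one_le_pow₀ (by norm_num)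
  calc (√(4 * Real.pi * (k * β)))⁻¹ ^ d
      ≤ (1 * ((√(4 * Real.pi * β))⁻¹ ^ d + 0)) * ((√(k : ℝ))⁻¹ + 0) := by
        simpa using inv_sqrt_pow_le hd hk
    _ ≤ _ := by
        gcongr
        · positivity
        · split_ifs <;> positivity

/-- The lattice sum factorises over coordinates. The zero image gives the free kernel, and the other
images give the inverse volume of the torus. -/
theorem tsum_gaussBound_le (hd : 1 ≤ d) (hβ : 0 < β) {a : ℝ} (ha : 0 < a) {k : ℕ} (hk : 1 ≤ k)
    {c : ℝ} (hc : 0 ≤ c) (x : Space d) :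
    ∑' n : Fin d → ℤ, ENNReal.ofReal (c * gaussBound d β k x (x + latticePoint (2 * a) n))
      ≤ ENNReal.ofReal (c * kernelBound d β .per a k) := by
  have hβ' : (0 : ℝ) < β := hβ
  have hk' : (0 : ℝ) < k := by positivity
  set T : ℝ := k * β with hT
  have hT0 : 0 < T := by positivity
  set q : ℝ := (2 * a) ^ 2 / (8 * T) with hq
  have hq0 : 0 < q := by positivity
  have hterm : ∀ n : Fin d → ℤ,
      ENNReal.ofReal (c * gaussBound d β k x (x + latticePoint (2 * a) n))
      = ENNReal.ofReal (c * (√(4 * Real.pi * T))⁻¹ ^ d)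
        * ∏ i, ENNReal.ofReal (Real.exp (-q * (n i : ℝ) ^ 2)) := by
    intro n
    rw [← ENNReal.ofReal_prod_of_nonneg fun _ _ => (Real.exp_pos _).le,
      ← ENNReal.ofReal_mul (by positivity), ← Real.exp_sum]
    unfold gaussBound
    rw [rpow_neg_half_eq (by positivity), ← mul_assoc c, sub_add_cancel_left, norm_neg,
      EuclideanSpace.real_norm_sq_eq]
    congr 4
    rw [← Finset.sum_neg_distrib, Finset.sum_div]
    refine Finset.sum_congr rfl fun i _ => ?_
    simp only [latticePoint, hq]
    ring
  simp only [hterm]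
  rw [ENNReal.tsum_mul_left, tsum_pi_prod fun m : ℤ => ENNReal.ofReal (Real.exp (-q * (m : ℝ) ^ 2))]
  refine (mul_le_mul_right (pow_le_pow_left' (tsum_exp_neg_mul_sq_le hq0) d) _).trans ?_
  rw [← ENNReal.ofReal_pow (by positivity), ← ENNReal.ofReal_mul (by positivity)]
  apply ENNReal.ofReal_le_ofReal
  rw [mul_assoc c]
  gcongr
  rw [← mul_pow, mul_add, mul_one]
  -- The time `T` cancels, so the torus contribution is of order `1 / |Λ|` uniformly in the length.
  have h1 : (√(4 * Real.pi * T))⁻¹ * √(Real.pi / q) = √2 * (2 * a)⁻¹ := by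
    rw [← Real.sqrt_inv, ← Real.sqrt_mul (by positivity)]
    have : (4 * Real.pi * T)⁻¹ * (Real.pi / q) = 2 * ((2 * a)⁻¹) ^ 2 := by
      rw [hq]
      have := Real.pi_pos
      field_simp
      norm_num
    rw [this, Real.sqrt_mul (by norm_num), Real.sqrt_sq (by positivity)]
  rw [h1]
  refine (add_pow_le (by positivity) (by positivity) d).trans ?_
  unfold kernelBound kernelConst boxVolume
  rw [if_pos rfl, mul_assoc ((2 : ℝ) ^ (d - 1))]
  gcongr
  calc (√(4 * Real.pi * T))⁻¹ ^ d + (√2 * (2 * a)⁻¹) ^ d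
      ≤ (√(4 * Real.pi * β))⁻¹ ^ d * (√(k : ℝ))⁻¹ + √2 ^ d * ((2 * a) ^ d)⁻¹ := by
        rw [mul_pow, inv_pow (2 * a)]
        gcongr
        exact inv_sqrt_pow_le hd hk
    _ ≤ _ := by
        have h3 : 0 ≤ √2 ^ d * (√(k : ℝ))⁻¹ := by positivity
        have h4 : 0 ≤ (√(4 * Real.pi * β))⁻¹ ^ d * ((2 * a) ^ d)⁻¹ := by positivity
        nlinarith

theorem lintegral_bcBridgeMeasure_le (hd : 1 ≤ d) (hβ : 0 < β) (W : Measure C(ℝ≥0, Space d))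
    (bc : BC) {a : ℝ} (ha : 0 < a) {k : ℕ} (hk : 1 ≤ k) (x : Space d) {c : ℝ} (hc : 0 ≤ c)
    {F : PathSpace d β k → ℝ≥0∞}
    (hF : ∀ y, ∫⁻ f, F f ∂bridgeMeasure W β k x y ≤ ENNReal.ofReal (c * gaussBound d β k x y)) :
    ∫⁻ f, F f ∂bcBridgeMeasure W β bc a k x x ≤ ENNReal.ofReal (c * kernelBound d β bc a k) := by
  cases bc with
  | per =>
    rw [bcBridgeMeasure, lintegral_sum_measure]
    exact (ENNReal.tsum_le_tsum fun n => hF _).trans (tsum_gaussBound_le hd hβ ha hk hc x)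
  | zero =>
    refine (setLIntegral_le_lintegral _ _).trans ((hF x).trans (ENNReal.ofReal_le_ofReal ?_))
    exact mul_le_mul_of_nonneg_left (gaussBound_self_le hd ha hk x) hc
  | par =>
    refine (setLIntegral_le_lintegral _ _).trans ((hF x).trans (ENNReal.ofReal_le_ofReal ?_))
    exact mul_le_mul_of_nonneg_left (gaussBound_self_le hd ha hk x) hc

theorem IsWienerMeasure.isProbabilityMeasure {W : Measure C(ℝ≥0, Space d)} (hd : 1 ≤ d)
    (hW : IsWienerMeasure W) : IsProbabilityMeasure W :=
  (hW.brownian ⟨0, hd⟩).toIsPreBrownianReal.hasLaw_eval 0 |>.isProbabilityMeasure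

theorem heatKernel_le_gaussBound (k : ℕ) (x y : Space d) :
    heatKernel ((k : ℝ) * β) x y ≤ gaussBound d β k x y := by
  unfold heatKernel gaussBound
  gcongr _ * Real.exp ?_
  rw [neg_div, neg_div, neg_le_neg_iff]
  rcases eq_or_lt_of_le (show 0 ≤ (k : ℝ) * β by positivity) with h | h
  · simp [← h]
  · gcongr
    norm_num

theorem lintegral_bridgeMeasure_const_le (hd : 1 ≤ d) {W : Measure C(ℝ≥0, Space d)}
    (hW : IsWienerMeasure W) (k : ℕ) (x y : Space d) {c : ℝ} (hc : 0 ≤ c) :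
    ∫⁻ _, ENNReal.ofReal c ∂bridgeMeasure W β k x y ≤ ENNReal.ofReal (c * gaussBound d β k x y) := by
  have := hW.isProbabilityMeasure hd
  rw [lintegral_bridgeMeasure W k x y measurable_const, lintegral_const, measure_univ, mul_one,
    mul_comm, ← ENNReal.ofReal_mul hc]
  exact ENNReal.ofReal_le_ofReal
    (mul_le_mul_of_nonneg_left (heatKernel_le_gaussBound k x y) hc)

/-- The bridge starts at `x` only almost surely, since `w 0 = 0` holds `W`-almost everywhere. -/
theorem lintegral_eval_zero_le (hd : 1 ≤ d) {W : Measure C(ℝ≥0, Space d)}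
    (hW : IsWienerMeasure W) (k : ℕ) (x y : Space d) (G : Space d → ℝ≥0∞) (hG : Measurable G) :
    ∫⁻ f : PathSpace d β k, G (Path.eval ⟨k, f⟩ 0) ∂bridgeMeasure W β k x y
      ≤ G x * ENNReal.ofReal (gaussBound d β k x y) := by
  have := hW.isProbabilityMeasure hd
  have hm : Measurable fun f : PathSpace d β k => G (Path.eval ⟨k, f⟩ 0) :=
    hG.comp (measurable_evalMap (T := Set.Iic ((k : ℝ≥0) * β)) (d := d)
      ⟨min (0 : ℝ).toNNReal ((k : ℝ≥0) * β), Set.mem_Iic.2 (min_le_right _ _)⟩)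
  have h0 : ∀ᵐ w ∂W, ∀ c, w 0 c = 0 :=
    ae_all_iff.2 fun c => (hW.brownian c).toIsPreBrownianReal.eval_zero_ae_eq_zero
  rw [lintegral_bridgeMeasure W k x y hm, mul_comm]
  refine mul_le_mul' ?_ (ENNReal.ofReal_le_ofReal (heatKernel_le_gaussBound k x y))
  calc _ = ∫⁻ w, G x ∂W := by
        refine lintegral_congr_ae ?_
        filter_upwards [h0] with w hw
        congr 1
        have := eval_of_le (bridgePath (k * β) x y w) (zero_le : 0 ≤ (k * β : ℝ≥0))
        rw [NNReal.coe_zero] at this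
        rw [this]
        ext c
        rw [bridgePath_apply]
        simp [hw c]
    _ ≤ _ := by simp

end Masses

/-! ### The potential in the box -/

section Potential

variable {d : ℕ} {β : ℝ≥0} {v : Space d → ℝ}

/-- Finiteness is uniform on a ball around `y`: this local finiteness gives the continuity of the
periodised potential. -/
theorem finite_lattice_near (hv : HasCompactSupport v) {a : ℝ} (ha : 0 < a) (y : Space d) :
    {n : Fin d → ℤ | ∃ z ∈ Metric.ball y 1, v (z + latticePoint (2 * a) n) ≠ 0}.Finite := by
  obtain ⟨R, hR⟩ := hv.isBounded.subset_closedBall 0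
  set M : ℤ := ⌈(R + ‖y‖ + 1) / (2 * a)⌉ with hM
  refine (Set.finite_Icc (fun _ : Fin d => -M) (fun _ => M)).subset ?_
  rintro n ⟨z, hz, hn⟩
  have h1 : ‖z + latticePoint (2 * a) n‖ ≤ R := by
    simpa using hR (subset_tsupport v hn)
  have h2 : ‖z‖ ≤ ‖y‖ + 1 := by
    have h3 : ‖z - y‖ < 1 := by simpa [dist_eq_norm] using hz
    have h4 := norm_add_le (z - y) y
    rw [sub_add_cancel] at h4
    linarith
  have h3 : ‖latticePoint (2 * a) n‖ ≤ R + ‖y‖ + 1 := by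
    have h4 := norm_sub_le (z + latticePoint (2 * a) n) z
    rw [add_sub_cancel_left] at h4
    linarith
  have h4 : ∀ i, |(n i : ℝ)| ≤ M := fun i => by
    have h5 := (PiLp.norm_apply_le (latticePoint (2 * a) n) i).trans h3
    simp only [latticePoint, Real.norm_eq_abs, abs_mul, abs_of_pos (show (0 : ℝ) < 2 * a by positivity)]
      at h5
    refine le_trans ?_ (Int.le_ceil _)
    rw [le_div_iff₀ (by positivity)]
    linarith
  have h5 : ∀ i, |n i| ≤ M := fun i => by exact_mod_cast h4 i
  exact ⟨fun i => (abs_le.1 (h5 i)).1, fun i => (abs_le.1 (h5 i)).2⟩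

theorem finite_lattice_support (hv : HasCompactSupport v) {a : ℝ} (ha : 0 < a) (y : Space d) :
    (Function.support fun n : Fin d → ℤ => v (y + latticePoint (2 * a) n)).Finite :=
  (finite_lattice_near hv ha y).subset fun _ hn => ⟨y, Metric.mem_ball_self one_pos, hn⟩

theorem continuous_bcPotential (hv : AssumptionV v) (bc : BC) {a : ℝ} (ha : 0 < a) :
    Continuous (bcPotential bc a v) := by
  cases bc with
  | per =>
    have : bcPotential .per a v = fun y => ∑ᶠ n : Fin d → ℤ, v (y + latticePoint (2 * a) n) := by
      ext y
      exact tsum_eq_finsum (finite_lattice_support hv.compactSupport ha y)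
    rw [this]
    refine continuous_finsum (fun n => hv.continuous.comp (continuous_id.add continuous_const))
      fun y => ⟨Metric.ball y 1, Metric.ball_mem_nhds y one_pos, ?_⟩
    refine (finite_lattice_near hv.compactSupport ha y).subset ?_
    rintro n ⟨z, hz, hzb⟩
    exact ⟨z, hzb, hz⟩
  | zero => exact hv.continuous
  | par => exact hv.continuous

theorem bcPotential_nonneg (hv : AssumptionV v) (bc : BC) (a : ℝ) (y : Space d) :
    0 ≤ bcPotential bc a v y := by
  cases bc with
  | per => exact tsum_nonneg fun n => hv.nonneg _
  | zero => exact hv.nonneg y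
  | par => exact hv.nonneg y

/-- The potential in the box dominates `v` at differences of points shifted by periods. -/
theorem le_bcPotential (hv : AssumptionV v) (bc : BC) {a : ℝ} (ha : 0 < a) (z y y' : Space d) :
    v (z + (position bc a y - y) - (position bc a y' - y')) ≤ bcPotential bc a v z := by
  cases bc with
  | per =>
    have hs : Summable fun n : Fin d → ℤ => v (z + latticePoint (2 * a) n) :=
      summable_of_hasFiniteSupport (finite_lattice_support hv.compactSupport ha z)
    -- The two shifts are periods, so the left side is a single term of the periodisation; its index
    -- is the difference of the integer parts.
    refine le_trans (le_of_eq ?_) (hs.le_tsum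
      (fun i => ⌊(y' i + a) / (2 * a)⌋ - ⌊(y i + a) / (2 * a)⌋) fun n _ => hv.nonneg _)
    congr 1
    ext i
    simp [position, latticePoint]
    ring
  | zero => simp [position, bcPotential]
  | par => simp [position, bcPotential]

theorem position_per_mem_cube {a : ℝ} (ha : 0 < a) (y : Space d) :
    position .per a y ∈ cube (0 : Space d) a := by
  intro i
  have h2a : (0 : ℝ) < 2 * a := by positivity
  have h1 := Int.floor_le ((y i + a) / (2 * a))
  have h2 := Int.lt_floor_add_one ((y i + a) / (2 * a))
  rw [le_div_iff₀ h2a] at h1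
  rw [div_lt_iff₀ h2a] at h2
  simp only [position, PiLp.zero_apply, sub_zero]
  rw [abs_le]
  constructor <;> nlinarith

end Potential

/-! ### Lower bounds on the energy -/

section Energy

variable {d : ℕ} {β : ℝ≥0}

/-- The superstability bound, with constant `C`. -/
def Superstable (C : ℝ) (v : Space d → ℝ) : Prop :=
  ∀ lo hi : Fin d → ℝ, (∀ i, lo i ≤ -1 ∧ 1 ≤ hi i) →
    ∀ (k : ℕ) (x : Fin k → Space d), (∀ p i, lo i ≤ x p i ∧ x p i ≤ hi i) →
      C * ((k : ℝ) ^ 2 / (∏ i, (hi i - lo i)) - k)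
        ≤ ∑ p, ∑ q ∈ Finset.univ.filter (fun q => p < q), v (x p - x q)

/-- Superstability bounds the sum over pairs `p < q` of an enumeration. Averaging over an
enumeration and its reverse gives half the sum over ordered pairs, without symmetry of `v`. Only
differences enter, so the cube may be centred anywhere. -/
theorem Superstable.sum_ne_ge {C : ℝ} {v : Space d → ℝ} (hC : Superstable C v) {ι : Type*}
    [DecidableEq ι] (I : Finset ι) (u : ι → Space d) (z : Space d) {b : ℝ} (hb : 1 ≤ b)
    (hu : ∀ i ∈ I, u i ∈ cube z b) :
    C * ((I.card : ℝ) ^ 2 / (2 * b) ^ d - I.card)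
      ≤ ∑ i ∈ I, ∑ j ∈ I, (1 / 2 : ℝ) * if i ≠ j then v (u i - u j) else 0 := by
  set e := I.equivFin.symm with he
  set N := I.card with hN
  have hbox : ∀ g : Fin N → Fin N, C * ((N : ℝ) ^ 2 / (2 * b) ^ d - N)
      ≤ ∑ p, ∑ q ∈ Finset.univ.filter (fun q => p < q), v (u (e (g p)) - u (e (g q))) := by
    intro g
    have h := hC (fun _ => -b) (fun _ => b) (fun _ => ⟨by linarith, hb⟩) N
      (fun p => u (e (g p)) - z) (fun p i => abs_le.1 (hu _ (e (g p)).2 i))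
    have h2 : ∏ _i : Fin d, (b - -b) = (2 * b) ^ d := by simp; ring
    simpa only [h2, sub_sub_sub_cancel_right] using h
  have h1 := hbox id
  have h2 := hbox Fin.rev
  have h3 : ∑ p : Fin N, ∑ q ∈ Finset.univ.filter (fun q => p < q),
      v (u (e (Fin.rev p)) - u (e (Fin.rev q)))
      = ∑ p : Fin N, ∑ q ∈ Finset.univ.filter (fun q => q < p), v (u (e p) - u (e q)) := by
    refine Fintype.sum_equiv Fin.revPerm _ _ fun p => ?_
    rw [Finset.sum_filter, Finset.sum_filter]
    refine Fintype.sum_equiv Fin.revPerm _ _ fun q => ?_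
    simp
  rw [h3] at h2
  have h4 : ∑ i ∈ I, ∑ j ∈ I, (1 / 2 : ℝ) * (if i ≠ j then v (u i - u j) else 0)
      = 1 / 2 * (∑ p : Fin N, ∑ q ∈ Finset.univ.filter (fun q => p < q), v (u (e p) - u (e q))
        + ∑ p : Fin N, ∑ q ∈ Finset.univ.filter (fun q => q < p), v (u (e p) - u (e q))) := by
    rw [← Finset.sum_add_distrib, Finset.mul_sum, ← Finset.sum_coe_sort I]
    refine (Fintype.sum_equiv e _ _ fun p => ?_).symm
    rw [Finset.sum_filter, Finset.sum_filter, ← Finset.sum_add_distrib, Finset.mul_sum,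
      ← Finset.sum_coe_sort I]
    refine Fintype.sum_equiv e _ _ fun q => ?_
    rcases lt_trichotomy p q with h | h | h
    · simp [h, h.not_gt, h.ne]
    · simp [h]
    · simp [h, h.not_gt, h.ne']
  rw [h4]
  simp only [id] at h1
  linarith

/-- The interaction of the different legs of a path with each other. -/
noncomputable def selfEnergy (V : Space d → ℝ) (f : Path d β) : ℝ :=
  ∑ i ∈ Finset.range f.1, ∑ j ∈ Finset.range f.1,
    (1 / 2 : ℝ) * if i ≠ j then legInteraction V f f i j else 0

theorem legInteraction_nonneg {V : Space d → ℝ} (hV : ∀ y, 0 ≤ V y) (f g : Path d β) (i j : ℕ) :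
    0 ≤ legInteraction V f g i j :=
  intervalIntegral.integral_nonneg β.2 fun _ _ => hV _

/-- The diagonal terms `q = p` are kept and the nonnegative terms between different loops are
dropped. This decouples the loops. -/
theorem sum_selfEnergy_le_interaction {V : Space d → ℝ} (hV : ∀ y, 0 ≤ V y)
    (ω : Config (MarkedPoint d β)) : ∑ p, selfEnergy V (ω.2 p).2 ≤ interaction V ω := by
  unfold interaction
  refine Finset.sum_le_sum fun p _ => ?_
  refine le_trans (le_of_eq ?_) (Finset.single_le_sum
    (f := fun q => (1 / 2 : ℝ) * ∑ i ∈ Finset.range (ω.2 p).2.1, ∑ j ∈ Finset.range (ω.2 q).2.1,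
      if (p, i) ≠ (q, j) then legInteraction V (ω.2 p).2 (ω.2 q).2 i j else 0)
    (fun q _ => ?_) (Finset.mem_univ p))
  · simp only [selfEnergy, Finset.mul_sum, ne_eq, Prod.mk.injEq, true_and]
  · refine mul_nonneg (by norm_num) (Finset.sum_nonneg fun i _ => Finset.sum_nonneg fun j _ => ?_)
    split_ifs
    · exact legInteraction_nonneg hV _ _ _ _
    · exact le_rfl

theorem continuous_legInteraction_integrand {V : Space d → ℝ} (hV : Continuous V) (f : Path d β)
    (i j : ℕ) : Continuous fun s : ℝ =>
      (1 / 2 : ℝ) * if i ≠ j then V (f.eval (i * β + s) - f.eval (j * β + s)) else 0 := by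
  have h : ∀ i : ℕ, Continuous fun s : ℝ => f.eval (i * β + s) := fun i =>
    (continuous_eval f).comp (by fun_prop)
  by_cases hij : i = j
  · simp only [hij, ne_eq, not_true_eq_false, if_false]
    exact continuous_const
  · simp only [ne_eq, hij, not_false_eq_true, if_true]
    exact continuous_const.mul (hV.comp ((h i).sub (h j)))

theorem selfEnergy_eq_integral {V : Space d → ℝ} (hV : Continuous V) (f : Path d β) :
    selfEnergy V f = ∫ s in (0 : ℝ)..β, ∑ i ∈ Finset.range f.1, ∑ j ∈ Finset.range f.1,
      (1 / 2 : ℝ) * if i ≠ j then V (f.eval (i * β + s) - f.eval (j * β + s)) else 0 := by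
  have hcont := continuous_legInteraction_integrand hV f
  rw [intervalIntegral.integral_finsetSum fun i _ =>
    (continuous_finsetSum _ fun j _ => hcont i j).intervalIntegrable _ _]
  unfold selfEnergy legInteraction
  refine Finset.sum_congr rfl fun i _ => ?_
  rw [intervalIntegral.integral_finsetSum fun j _ => (hcont i j).intervalIntegrable _ _]
  refine Finset.sum_congr rfl fun j _ => ?_
  rw [intervalIntegral.integral_const_mul]
  by_cases hij : i = j <;> simp [hij]

/-- If a function of the time is below the interaction density of a subset of the legs at all
times, its integral is below the self-energy. -/
theorem integral_le_selfEnergy {V : Space d → ℝ} (hV : Continuous V) (f : Path d β) {g : ℝ → ℝ}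
    (hg : Continuous g)
    (hle : ∀ s : ℝ, 0 ≤ s → s ≤ β → g s ≤ ∑ i ∈ Finset.range f.1, ∑ j ∈ Finset.range f.1,
      (1 / 2 : ℝ) * if i ≠ j then V (f.eval (i * β + s) - f.eval (j * β + s)) else 0) :
    ∫ s in (0 : ℝ)..β, g s ≤ selfEnergy V f := by
  rw [selfEnergy_eq_integral hV]
  exact intervalIntegral.integral_mono_on β.2 (hg.intervalIntegrable _ _)
    ((continuous_finsetSum _ fun i _ => continuous_finsetSum _ fun j _ =>
      continuous_legInteraction_integrand hV f i j).intervalIntegrable _ _) fun s hs => hle s hs.1 hs.2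

/-- The superstability bound for shifted points of a path. -/
theorem superstable_subset_le {C : ℝ} {v V : Space d → ℝ} (hC : Superstable C v)
    (hV0 : ∀ y, 0 ≤ V y) {k : ℕ} {I : Finset ℕ} (hI : I ⊆ Finset.range k) (u τ : ℕ → Space d)
    (hV : ∀ i j, v (u i + τ i - (u j + τ j)) ≤ V (u i - u j)) (z : Space d) {b : ℝ} (hb : 1 ≤ b)
    (hu : ∀ i ∈ I, u i + τ i ∈ cube z b) :
    C * ((I.card : ℝ) ^ 2 / (2 * b) ^ d - I.card)
      ≤ ∑ i ∈ Finset.range k, ∑ j ∈ Finset.range k,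
        (1 / 2 : ℝ) * if i ≠ j then V (u i - u j) else 0 := by
  have hnn : ∀ i j, 0 ≤ (1 / 2 : ℝ) * if i ≠ j then V (u i - u j) else 0 := fun i j => by
    have := hV0 (u i - u j)
    split_ifs <;> positivity
  calc _ ≤ ∑ i ∈ I, ∑ j ∈ I, (1 / 2 : ℝ) * if i ≠ j then v (u i + τ i - (u j + τ j)) else 0 :=
        hC.sum_ne_ge I _ z hb hu
    _ ≤ ∑ i ∈ I, ∑ j ∈ I, (1 / 2 : ℝ) * if i ≠ j then V (u i - u j) else 0 := by
        gcongr with i _ j _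
        split_ifs
        · exact hV i j
        · exact le_rfl
    _ ≤ ∑ i ∈ I, ∑ j ∈ Finset.range k, (1 / 2 : ℝ) * if i ≠ j then V (u i - u j) else 0 :=
        Finset.sum_le_sum fun i _ => Finset.sum_le_sum_of_subset_of_nonneg hI fun j _ _ => hnn i j
    _ ≤ _ := Finset.sum_le_sum_of_subset_of_nonneg hI fun i _ _ =>
        Finset.sum_nonneg fun j _ => hnn i j

variable {v : Space d → ℝ} {C : ℝ}

/-- On the torus, long loops have a superstable energy. -/
theorem selfEnergy_per_ge (hv : AssumptionV v) (hC : Superstable C v) {a : ℝ} (ha : 1 ≤ a)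
    (f : Path d β) :
    β * (C * ((f.1 : ℝ) ^ 2 / boxVolume d a - f.1)) ≤ selfEnergy (bcPotential .per a v) f := by
  have ha0 : 0 < a := by linarith
  refine le_trans (le_of_eq ?_) (integral_le_selfEnergy (continuous_bcPotential hv .per ha0) f
    (g := fun _ => C * ((f.1 : ℝ) ^ 2 / boxVolume d a - f.1)) continuous_const fun s _ _ => ?_)
  · rw [intervalIntegral.integral_const, sub_zero, smul_eq_mul]
  -- At each time every leg is moved by a period into `Λ`, which contains `[-1,1]^d` because `a ≥
  -- 1`.
  · have h := superstable_subset_le hC (bcPotential_nonneg hv .per a) (Finset.Subset.refl _)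
      (k := f.1) (fun i => f.eval (i * β + s))
      (fun i => position .per a (f.eval (i * β + s)) - f.eval (i * β + s))
      (fun i j => by
        convert! le_bcPotential hv .per ha0 (f.eval (i * β + s) - f.eval (j * β + s))
          (f.eval (i * β + s)) (f.eval (j * β + s)) using 2
        abel) 0 ha (fun i _ => by
        simpa using position_per_mem_cube ha0 (f.eval (i * β + s)))
    simpa [boxVolume] using h

/-- Legs with a small displacement. -/
theorem le_card_small_displacement (f : Path d β) (s : ℝ) {D : ℝ} (hD : 0 < D) :
    (f.1 : ℝ) - displacement s f / D
      ≤ ((Finset.range f.1).filter fun i : ℕ =>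
        ∑ c, |f.eval (i * β + s) c - f.eval (i * β) c| ≤ D).card := by
  have h1 : (((Finset.range f.1).filter fun i : ℕ =>
      ¬ ∑ c, |f.eval (i * β + s) c - f.eval (i * β) c| ≤ D).card : ℝ) * D ≤ displacement s f := by
    rw [← nsmul_eq_mul]
    refine (Finset.card_nsmul_le_sum _ (fun i : ℕ => ∑ c, |f.eval (i * β + s) c - f.eval (i * β) c|)
      D fun i hi => ?_).trans ?_
    · exact (not_le.1 (Finset.mem_filter.1 hi).2).le
    · exact Finset.sum_le_sum_of_subset_of_nonneg (Finset.filter_subset _ _) fun i _ _ =>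
        Finset.sum_nonneg fun c _ => abs_nonneg _
  have h2 := Finset.card_filter_add_card_filter_not (s := Finset.range f.1)
    (fun i : ℕ => ∑ c, |f.eval (i * β + s) c - f.eval (i * β) c| ≤ D)
  rw [Finset.card_range] at h2
  have h3 := congrArg (Nat.cast : ℕ → ℝ) h2
  rw [sub_le_iff_le_add, ← sub_le_iff_le_add', le_div_iff₀ hD]
  refine le_trans (mul_le_mul_of_nonneg_right ?_ hD.le) h1
  push_cast at h3
  linarith

/-- The energy of a noncrossing loop is superstable in the subbox, up to the displacements of its
legs from their starting points. -/
theorem selfEnergy_nonCrossing_ge (hv : AssumptionV v) (hC0 : 0 ≤ C) (hC : Superstable C v) (bc : BC)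
    {a : ℝ} (ha : 0 < a) {r D : ℝ} (hr : 0 ≤ r) (hD : 1 ≤ D) (f : Path d β)
    (hf : NonCrossing bc a r f) :
    β * (C * (3 / 4 * (f.1 : ℝ) ^ 2 / (2 * (r + D)) ^ d - f.1))
        - C * f.1 / (D * (2 * (r + D)) ^ d) * ∫ s in (0 : ℝ)..β, displacement s f
      ≤ selfEnergy (bcPotential bc a v) f := by
  obtain ⟨n, hn⟩ := hf
  have hD0 : 0 < D := by linarith
  set B : ℝ := (2 * (r + D)) ^ d with hB
  have hB0 : 0 < B := by positivity
  refine le_trans (le_of_eq ?_) (integral_le_selfEnergy (continuous_bcPotential hv bc ha) f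
    (g := fun s => C * (3 / 4 * (f.1 : ℝ) ^ 2 / B - f.1) - C * f.1 / (D * B) * displacement s f)
    (continuous_const.sub (continuous_const.mul (continuous_displacement f))) fun s hs0 hs => ?_)
  · rw [intervalIntegral.integral_sub (continuous_const.intervalIntegrable _ _)
      (((continuous_displacement f).intervalIntegrable _ _).const_mul _),
      intervalIntegral.integral_const, sub_zero, smul_eq_mul, intervalIntegral.integral_const_mul]
  · set I := (Finset.range f.1).filter fun i : ℕ =>
      ∑ c, |f.eval (i * β + s) c - f.eval (i * β) c| ≤ D with hI
    -- The whole leg is shifted by the period of its starting particle. The shifted starting point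
    -- lies in the subbox, and small displacement keeps the leg in the subbox enlarged by `D`.
    have h := superstable_subset_le hC (bcPotential_nonneg hv bc a)
      (Finset.filter_subset _ _ : I ⊆ Finset.range f.1) (fun i => f.eval (i * β + s))
      (fun i => position bc a (f.eval (i * β)) - f.eval (i * β))
      (fun i j => by
        convert! le_bcPotential hv bc ha (f.eval (i * β + s) - f.eval (j * β + s))
          (f.eval (i * β)) (f.eval (j * β)) using 2
        abel) (latticePoint (2 * r) n) (b := r + D) (by linarith) (fun i hi c => by
        obtain ⟨hi1, hi2⟩ := Finset.mem_filter.1 hi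
        have h1 := hn i (Finset.mem_range.1 hi1) c
        have h2 : |f.eval (i * β + s) c - f.eval (i * β) c| ≤ D :=
          (Finset.single_le_sum (f := fun c => |f.eval (i * β + s) c - f.eval (i * β) c|)
            (fun c _ => abs_nonneg _) (Finset.mem_univ c)).trans hi2
        simp only [PiLp.add_apply, PiLp.sub_apply]
        refine le_trans (le_of_eq ?_) ((abs_add_le _ _).trans (add_le_add h1 h2))
        congr 1; ring)
    refine le_trans ?_ h
    have hcard := le_card_small_displacement f s hD0
    have hcard2 : (I.card : ℝ) ≤ f.1 := by
      have := Finset.card_filter_le (Finset.range f.1)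
        fun i : ℕ => ∑ c, |f.eval (i * β + s) c - f.eval (i * β) c| ≤ D
      rw [Finset.card_range] at this
      exact_mod_cast this
    rw [← hI] at hcard
    rw [← hB]
    have hk0 : (0 : ℝ) ≤ f.1 := Nat.cast_nonneg _
    -- With `n` legs in `I` and length `k`, the bound `n² ≥ k n - k² / 4` is used. It is linear in
    -- `n`, so `n ≥ k - displacement / D` can be inserted even if the right side is negative.
    calc _ = C * ((f.1 * (f.1 - displacement s f / D) - (f.1 : ℝ) ^ 2 / 4) / B - f.1) := by
          field_simp; ring
      _ ≤ C * ((f.1 * I.card - (f.1 : ℝ) ^ 2 / 4) / B - I.card) := by gcongr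
      _ ≤ _ := by
          gcongr
          nlinarith [sq_nonneg ((I.card : ℝ) - f.1 / 2)]

/-- Jensen's inequality, from the tangent line of `exp` at the mean. -/
theorem exp_average_le {g : ℝ → ℝ} (hg : Continuous g) {b : ℝ} (hb : 0 < b) :
    Real.exp (b⁻¹ * ∫ s in (0 : ℝ)..b, g s) ≤ b⁻¹ * ∫ s in (0 : ℝ)..b, Real.exp (g s) := by
  set m := b⁻¹ * ∫ s in (0 : ℝ)..b, g s with hm
  have hint : ∫ s in (0 : ℝ)..b, g s = b * m := by rw [hm]; field_simp
  have h1 : ∫ s in (0 : ℝ)..b, Real.exp m * (1 - m + g s) ≤ ∫ s in (0 : ℝ)..b, Real.exp (g s) := by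
    refine intervalIntegral.integral_mono_on hb.le
      ((continuous_const.mul (continuous_const.add hg)).intervalIntegrable _ _)
      ((Real.continuous_exp.comp hg).intervalIntegrable _ _) fun s _ => ?_
    have h2 := Real.add_one_le_exp (g s - m)
    have h3 : Real.exp (g s) = Real.exp m * Real.exp (g s - m) := by rw [← Real.exp_add]; ring_nf
    rw [h3]
    gcongr
    linarith
  rw [intervalIntegral.integral_const_mul, intervalIntegral.integral_add
    (continuous_const.intervalIntegrable _ _) (hg.intervalIntegrable _ _), hint,
    intervalIntegral.integral_const, sub_zero, smul_eq_mul] at h1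
  rw [inv_mul_eq_div, le_div_iff₀ hb]
  linarith

/-- The bound on the Boltzmann factor of long noncrossing loops. -/
theorem exp_sub_selfEnergy_le (hv : AssumptionV v) (hC0 : 0 ≤ C) (hC : Superstable C v) (bc : BC)
    {a : ℝ} (ha : 0 < a) (hβ : 0 < β) {r D θ : ℝ} (hr : 0 ≤ r) (hD : 1 ≤ D) (f : Path d β)
    (hf : NonCrossing bc a r f)
    (hθ : θ ≤ β * (C * (1 / 2 * (f.1 : ℝ) / (2 * (r + D)) ^ d - 1))) :
    ENNReal.ofReal (Real.exp (θ * f.1 - selfEnergy (bcPotential bc a v) f))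
      ≤ 1 + ENNReal.ofReal (Real.exp ((θ - D / 4) * f.1) * (β : ℝ)⁻¹)
        * ∫⁻ s in Set.Ioc (0 : ℝ) β, ENNReal.ofReal (Real.exp (displacement s f)) := by
  have hβ' : (0 : ℝ) < β := hβ
  have hD0 : 0 < D := by linarith
  have hk0 : (0 : ℝ) ≤ f.1 := Nat.cast_nonneg _
  set B : ℝ := (2 * (r + D)) ^ d with hB
  have hB0 : 0 < B := by positivity
  set J := ∫ s in (0 : ℝ)..β, displacement s f with hJ
  have hE := selfEnergy_nonCrossing_ge hv hC0 hC bc ha hr hD f hf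
  rw [← hB, ← hJ] at hE
  have hE0 : 0 ≤ selfEnergy (bcPotential bc a v) f :=
    Finset.sum_nonneg fun i _ => Finset.sum_nonneg fun j _ => by
      have := legInteraction_nonneg (bcPotential_nonneg hv bc a) f f i j
      split_ifs <;> positivity
  -- If the average displacement is at most `D k / 4`, the coefficient of the quadratic energy is
  -- still `3/4 - 1/4 = 1/2`, and the energy exceeds `θ k`. Otherwise the energy is discarded, and
  -- `1 ≤ exp(average - D k / 4)` is combined with Jensen's inequality.
  rcases le_or_gt J (β * (D * f.1 / 4)) with hcase | hcase
  · refine le_trans ?_ le_self_add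
    rw [← ENNReal.ofReal_one]
    apply ENNReal.ofReal_le_ofReal
    rw [Real.exp_le_one_iff, sub_nonpos]
    refine le_trans ?_ hE
    calc θ * f.1 ≤ β * (C * (1 / 2 * (f.1 : ℝ) / B - 1)) * f.1 := by gcongr
      _ = β * (C * (3 / 4 * (f.1 : ℝ) ^ 2 / B - f.1))
          - C * f.1 / (D * B) * (β * (D * f.1 / 4)) := by field_simp; ring
      _ ≤ _ := by gcongr
  · refine le_trans ?_ le_add_self
    have hlint : ∫⁻ s in Set.Ioc (0 : ℝ) β, ENNReal.ofReal (Real.exp (displacement s f))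
        = ENNReal.ofReal (∫ s in (0 : ℝ)..β, Real.exp (displacement s f)) := by
      have hc : Continuous fun s => Real.exp (displacement s f) :=
        Real.continuous_exp.comp (continuous_displacement f)
      rw [intervalIntegral.integral_of_le hβ'.le, ofReal_integral_eq_lintegral_ofReal
        (hc.intervalIntegrable 0 (β : ℝ)).1
        (Filter.Eventually.of_forall fun _ => (Real.exp_pos _).le)]
    rw [hlint, ← ENNReal.ofReal_mul (by positivity)]
    apply ENNReal.ofReal_le_ofReal
    rw [mul_assoc]
    refine le_trans ?_ (mul_le_mul_of_nonneg_left
      (exp_average_le (continuous_displacement f) hβ') (Real.exp_pos _).le)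
    rw [← Real.exp_add, ← hJ]
    apply Real.exp_le_exp.2
    have : D * f.1 / 4 ≤ (β : ℝ)⁻¹ * J := by
      rw [inv_mul_eq_div, le_div_iff₀ hβ']
      linarith
    linarith

end Energy

/-! ### Volumes of cubes -/

section Volume

variable {d : ℕ}

theorem volume_cube (c : Space d) {r : ℝ} (hr : 0 ≤ r) :
    volume (cube c r) = ENNReal.ofReal ((2 * r) ^ d) := by
  have h : cube c r = (WithLp.ofLp : Space d → Fin d → ℝ) ⁻¹' Metric.closedBall (WithLp.ofLp c) r := by
    ext y
    simp only [cube, Set.mem_ofPred_eq, Set.mem_preimage, Metric.mem_closedBall, dist_pi_le_iff hr,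
      Real.dist_eq]
  rw [h, (PiLp.volume_preserving_ofLp (Fin d)).measure_preimage
    Metric.isClosed_closedBall.measurableSet.nullMeasurableSet, Real.volume_pi_closedBall _ hr,
    Fintype.card_fin]

theorem measurableSet_cube (c : Space d) (r : ℝ) : MeasurableSet (cube c r) := by
  have : cube c r = ⋂ i, {y : Space d | |y i - c i| ≤ r} := by ext y; simp [cube]
  rw [this]
  exact MeasurableSet.iInter fun i => measurableSet_le (by fun_prop) measurable_const

end Volume

/-! ### The loop soup -/

section Soup

variable {d : ℕ} {β : ℝ≥0}

/-- Only an upper bound is needed, and it holds without measurability of the kernel in the starting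
point. -/
theorem lintegral_intensity_le (W : Measure C(ℝ≥0, Space d)) (bc : BC) (a : ℝ)
    (F : MarkedPoint d β → ℝ≥0∞) :
    ∫⁻ z, F z ∂intensity W β bc a ≤ ∑' k : ℕ+, ((k : ℕ) : ℝ≥0∞)⁻¹ *
      ∫⁻ x in cube (0 : Space d) a, ∫⁻ f, F (x, ⟨k, f⟩) ∂bcBridgeMeasure W β bc a k x x := by
  unfold intensity
  rw [lintegral_sum_measure]
  refine ENNReal.tsum_le_tsum fun k => ?_
  rw [lintegral_smul_measure, smul_eq_mul]
  gcongr
  refine (Measure.lintegral_bind_le _ _ _).trans ?_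
  gcongr with x
  exact lintegral_map_le _ _

theorem lintegral_cube_const_le (hd : 1 ≤ d) (hβ : 0 < β) {W : Measure C(ℝ≥0, Space d)}
    (hW : IsWienerMeasure W) (bc : BC) {a : ℝ} (ha : 0 < a) {k : ℕ} (hk : 1 ≤ k) {c : ℝ}
    (hc : 0 ≤ c) :
    ∫⁻ x in cube (0 : Space d) a, ∫⁻ _, ENNReal.ofReal c ∂bcBridgeMeasure W β bc a k x x
      ≤ ENNReal.ofReal (boxVolume d a * (c * kernelBound d β bc a k)) := by
  calc _ ≤ ∫⁻ _ in cube (0 : Space d) a, ENNReal.ofReal (c * kernelBound d β bc a k) := by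
        gcongr with x
        exact lintegral_bcBridgeMeasure_le hd hβ W bc ha hk x hc fun y =>
          lintegral_bridgeMeasure_const_le hd hW k x y hc
    _ = _ := by
        have : 0 ≤ boxVolume d a := by unfold boxVolume; positivity
        rw [setLIntegral_const, volume_cube _ ha.le, mul_comm, ENNReal.ofReal_mul this]
        rfl

/-- The sets of loops of length at most `n` exhaust the space and have finite mass. -/
theorem sigmaFinite_intensity (hd : 1 ≤ d) (hβ : 0 < β) {W : Measure C(ℝ≥0, Space d)}
    (hW : IsWienerMeasure W) (bc : BC) {a : ℝ} (ha : 0 < a) : SigmaFinite (intensity W β bc a) := by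
  have hms : ∀ n : ℕ, MeasurableSet {z : MarkedPoint d β | z.2.1 ≤ n} := fun n =>
    measurable_snd (measurable_sigma_of (f := fun f : Path d β => f.1) (fun _ => measurable_const)
      (measurableSet_Iic : MeasurableSet (Set.Iic n)))
  refine ⟨⟨⟨fun n => {z | z.2.1 ≤ n}, fun _ => trivial, fun n => ?_, ?_⟩⟩⟩
  · rw [← lintegral_indicator_one (hms n)]
    refine (lintegral_intensity_le W bc a _).trans_lt ?_
    rw [tsum_eq_sum (s := Finset.Icc 1 n.succPNat)]
    · refine ENNReal.sum_lt_top.2 fun k _ => ENNReal.mul_lt_top ?_ ?_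
      · exact ENNReal.inv_lt_top.2 (by exact_mod_cast k.pos)
      · refine lt_of_le_of_lt ?_ (ENNReal.ofReal_lt_top
          (r := boxVolume d a * (1 * kernelBound d β bc a k)))
        refine le_trans ?_ (lintegral_cube_const_le hd hβ hW bc ha k.pos zero_le_one)
        gcongr with x f
        rw [ENNReal.ofReal_one]
        exact Set.indicator_le_self' (fun _ _ => zero_le) _
    · intro k hk
      have hk' : ¬ ((k : ℕ) ≤ n) := fun h => hk (Finset.mem_Icc.2 ⟨one_le, by
        rw [← PNat.coe_le_coe, Nat.succPNat_coe]; omega⟩)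
      simp [Set.indicator, hk']
  · ext z
    simp only [Set.mem_iUnion, Set.mem_ofPred_eq, Set.mem_univ, iff_true]
    exact ⟨_, le_rfl⟩

theorem tsum_indicator_lt_le {y : ℝ} (hy : 0 ≤ y) :
    ∑' k : ℕ+, ENNReal.ofReal (if ((k : ℕ) : ℝ) < y then 1 else 0) ≤ ENNReal.ofReal y := by
  rw [tsum_pnat_eq_tsum_succ (f := fun k : ℕ => ENNReal.ofReal (if (k : ℝ) < y then 1 else 0)),
    tsum_eq_sum (s := Finset.range ⌊y⌋₊)]
  · calc _ ≤ ∑ k ∈ Finset.range ⌊y⌋₊, (1 : ℝ≥0∞) := by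
          gcongr with k
          split_ifs <;> simp
      _ = ENNReal.ofReal (⌊y⌋₊ : ℝ) := by simp
      _ ≤ _ := ENNReal.ofReal_le_ofReal (Nat.floor_le hy)
  · intro k hk
    rw [Finset.mem_range, not_lt] at hk
    have := Nat.lt_floor_add_one y
    have h2 : (⌊y⌋₊ : ℝ) ≤ k := by exact_mod_cast hk
    rw [if_neg (by push_cast; linarith), ENNReal.ofReal_zero]

theorem summable_inv_mul_inv_sqrt :
    Summable fun k : ℕ+ => ((k : ℕ) : ℝ)⁻¹ * (√((k : ℕ) : ℝ))⁻¹ := by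
  have h := (Real.summable_nat_rpow_inv (p := 3 / 2)).2 (by norm_num)
  refine (h.comp_injective PNat.coe_injective).congr fun k => ?_
  have hk : (0 : ℝ) < ((k : ℕ) : ℝ) := by exact_mod_cast k.pos
  rw [Function.comp_apply, ← mul_inv, show (3 / 2 : ℝ) = 1 + 1 / 2 by norm_num,
    Real.rpow_add hk, Real.rpow_one, Real.sqrt_eq_rpow]

theorem summable_exp_neg_pnat : Summable fun k : ℕ+ => Real.exp (-((k : ℕ) : ℝ)) :=
  Real.summable_exp_neg_nat.comp_injective PNat.coe_injective

open Classical in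
/-- The sum over the lengths of the total masses of the tilted intensity measure. -/
theorem exists_tsum_kernelBound_le (d : ℕ) (β : ℝ≥0) :
    ∃ C₁ : ℝ, 0 ≤ C₁ ∧ ∀ K : ℝ, 1 ≤ K → ∃ C₂ : ℝ, 0 ≤ C₂ ∧ ∀ (bc : BC) (a : ℝ), 1 ≤ a →
      ∑' k : ℕ+, ENNReal.ofReal (((k : ℕ) : ℝ)⁻¹ * (boxVolume d a *
        ((if bc = .per ∧ K * boxVolume d a ≤ ((k : ℕ) : ℝ) then Real.exp (-((k : ℕ) : ℝ)) else 2)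
          * kernelBound d β bc a k))) ≤ ENNReal.ofReal (C₁ * boxVolume d a + C₂) := by
  set c := kernelConst d β with hc
  have hc0 : 0 ≤ c := kernelConst_nonneg
  set S₁ := ∑' k : ℕ+, ((k : ℕ) : ℝ)⁻¹ * (√((k : ℕ) : ℝ))⁻¹ with hS₁
  set S₂ := ∑' k : ℕ+, Real.exp (-((k : ℕ) : ℝ)) with hS₂
  have hS₁0 : 0 ≤ S₁ := tsum_nonneg fun k => by positivity
  have hS₂0 : 0 ≤ S₂ := tsum_nonneg fun k => by positivity
  refine ⟨2 * c * (S₁ + 1), by positivity, fun K hK => ⟨2 * c * (S₂ + K), by positivity,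
    fun bc a ha => ?_⟩⟩
  set V := boxVolume d a with hV
  have hV1 : 1 ≤ V := one_le_pow₀ (by linarith)
  have hV0 : 0 < V := by linarith
  have hK0 : 0 < K := by linarith
  -- The free part of the kernel sums to order `V`. The torus part, with `1 / V`, is split by
  -- length: `t ≥ K V` gives `exp(-t)`; for `K ≤ t < K V` at most `K V` terms of size `1 / K` again
  -- give order `V`, with a constant free of `K`; and `t < K` gives a constant depending on `K`.
  have hpt : ∀ k : ℕ+, ((k : ℕ) : ℝ)⁻¹ * (V *
        ((if bc = .per ∧ K * V ≤ ((k : ℕ) : ℝ) then Real.exp (-((k : ℕ) : ℝ)) else 2)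
          * kernelBound d β bc a k))
      ≤ 2 * c * V * (((k : ℕ) : ℝ)⁻¹ * (√((k : ℕ) : ℝ))⁻¹) + 2 * c * Real.exp (-((k : ℕ) : ℝ))
        + (2 * c * K⁻¹ * (if ((k : ℕ) : ℝ) < K * V then 1 else 0)
          + 2 * c * (if ((k : ℕ) : ℝ) < K then 1 else 0)) := by
    intro k
    have hk1 : (1 : ℝ) ≤ ((k : ℕ) : ℝ) := by exact_mod_cast k.pos
    have hk0 : (0 : ℝ) < ((k : ℕ) : ℝ) := by linarith
    unfold kernelBound
    rw [← hc, ← hV]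
    set t := ((k : ℕ) : ℝ) with ht
    have hti : t⁻¹ ≤ 1 := inv_le_one_of_one_le₀ hk1
    have hti0 : 0 ≤ t⁻¹ := by positivity
    have he0 := Real.exp_pos (-t)
    have he1 : Real.exp (-t) ≤ 1 := Real.exp_le_one_iff.2 (by linarith)
    have hu : 0 ≤ c * V * (t⁻¹ * (√t)⁻¹) := by positivity
    have hi1 : (0 : ℝ) ≤ 2 * c * K⁻¹ * (if t < K * V then 1 else 0) := by split_ifs <;> positivity
    have hi2 : (0 : ℝ) ≤ 2 * c * (if t < K then 1 else 0) := by split_ifs <;> positivity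
    have hce : 0 ≤ c * Real.exp (-t) := by positivity
    by_cases hper : bc = .per
    · simp only [hper, true_and, if_true]
      by_cases hlong : K * V ≤ t
      · rw [if_pos hlong]
        have e : t⁻¹ * (V * (Real.exp (-t) * (c * ((√t)⁻¹ + V⁻¹))))
            = Real.exp (-t) * (c * V * (t⁻¹ * (√t)⁻¹)) + t⁻¹ * (c * Real.exp (-t)) := by
          field_simp
        rw [e]
        have h1 : Real.exp (-t) * (c * V * (t⁻¹ * (√t)⁻¹)) ≤ 1 * (c * V * (t⁻¹ * (√t)⁻¹)) := by gcongr
        have h2 : t⁻¹ * (c * Real.exp (-t)) ≤ 1 * (c * Real.exp (-t)) := by gcongr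
        linarith
      · rw [if_neg hlong, if_pos (not_le.1 hlong)]
        have e : t⁻¹ * (V * (2 * (c * ((√t)⁻¹ + V⁻¹))))
            = 2 * (c * V * (t⁻¹ * (√t)⁻¹)) + 2 * c * t⁻¹ := by field_simp
        rw [e]
        by_cases hs : t < K
        · rw [if_pos hs]
          have h1 : 2 * c * t⁻¹ ≤ 2 * c * 1 := by gcongr
          have h2 : 0 ≤ 2 * c * K⁻¹ := by positivity
          linarith
        · rw [if_neg hs]
          have h1 : 2 * c * t⁻¹ ≤ 2 * c * K⁻¹ := by
            gcongr
            exact not_lt.1 hs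
          linarith
    · simp only [hper, false_and, if_false, add_zero]
      have e : t⁻¹ * (V * (2 * (c * (√t)⁻¹))) = 2 * (c * V * (t⁻¹ * (√t)⁻¹)) := by ring
      rw [e]
      linarith
  have hpos1 : ∀ k : ℕ+, 0 ≤ 2 * c * V * (((k : ℕ) : ℝ)⁻¹ * (√((k : ℕ) : ℝ))⁻¹) := fun k => by
    positivity
  have hpos2 : ∀ k : ℕ+, 0 ≤ 2 * c * Real.exp (-((k : ℕ) : ℝ)) := fun k => by positivity
  calc _ ≤ ∑' k : ℕ+, ((ENNReal.ofReal (2 * c * V * (((k : ℕ) : ℝ)⁻¹ * (√((k : ℕ) : ℝ))⁻¹))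
        + ENNReal.ofReal (2 * c * Real.exp (-((k : ℕ) : ℝ))))
        + (ENNReal.ofReal (2 * c * K⁻¹) * ENNReal.ofReal (if ((k : ℕ) : ℝ) < K * V then 1 else 0)
          + ENNReal.ofReal (2 * c) * ENNReal.ofReal (if ((k : ℕ) : ℝ) < K then 1 else 0))) := by
        refine ENNReal.tsum_le_tsum fun k => (ENNReal.ofReal_le_ofReal (hpt k)).trans ?_
        rw [← ENNReal.ofReal_mul (by positivity), ← ENNReal.ofReal_mul (by positivity)]
        exact ENNReal.ofReal_add_le.trans (add_le_add ENNReal.ofReal_add_le ENNReal.ofReal_add_le)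
    _ ≤ (ENNReal.ofReal (2 * c * V * S₁) + ENNReal.ofReal (2 * c * S₂))
        + (ENNReal.ofReal (2 * c * K⁻¹) * ENNReal.ofReal (K * V)
          + ENNReal.ofReal (2 * c) * ENNReal.ofReal K) := by
        rw [ENNReal.tsum_add, ENNReal.tsum_add, ENNReal.tsum_add, ENNReal.tsum_mul_left,
          ENNReal.tsum_mul_left, ← ENNReal.ofReal_tsum_of_nonneg hpos1
            (summable_inv_mul_inv_sqrt.mul_left _), tsum_mul_left,
          ← ENNReal.ofReal_tsum_of_nonneg hpos2 (summable_exp_neg_pnat.mul_left _), tsum_mul_left]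
        gcongr
        · exact tsum_indicator_lt_le (by positivity)
        · exact tsum_indicator_lt_le (by positivity)
    _ = _ := by
        rw [← ENNReal.ofReal_mul (by positivity), ← ENNReal.ofReal_mul (by positivity),
          ← ENNReal.ofReal_add (by positivity) (by positivity),
          ← ENNReal.ofReal_add (by positivity) (by positivity),
          ← ENNReal.ofReal_add (by positivity) (by positivity)]
        congr 1
        field_simp
        ring

open Classical in
/-- An exponential Chebyshev inequality for the transformed law, with a constant `C₁` that does not
depend on the exponent `θ`. -/
theorem exists_transformedLaw_le (hd : 1 ≤ d) (hβ : 0 < β) {W : Measure C(ℝ≥0, Space d)}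
    (hW : IsWienerMeasure W) {v : Space d → ℝ} (hv : AssumptionV v) {C : ℝ} (hC0 : 0 < C)
    (hC : Superstable C v) :
    ∃ C₁ : ℝ, ∀ θ : ℝ, 0 ≤ θ → ∃ C₂ : ℝ, ∀ (bc : BC) (a : ℝ), 1 ≤ a →
      ∀ (m : Path d β → ℕ) (X : Path d β → ℝ≥0∞), (∀ f, m f ≤ f.1) → Measurable X →
      (∀ f, ENNReal.ofReal (Real.exp (θ * m f - selfEnergy (bcPotential bc a v) f)) ≤ 1 + X f) →
      (∀ k : ℕ, 1 ≤ k → ∫⁻ x in cube (0 : Space d) a,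
        ∫⁻ f, X ⟨k, f⟩ ∂bcBridgeMeasure W β bc a k x x
          ≤ ENNReal.ofReal (boxVolume d a * kernelBound d β bc a k)) →
      ∀ c : ℝ, transformedLaw W β v bc a {ω | c < ((∑ p, m (ω.2 p).2 : ℕ) : ℝ)}
        ≤ ENNReal.ofReal (Real.exp (-(θ * c) + (C₁ * boxVolume d a + C₂))) := by
  obtain ⟨C₁, hC₁, hsum⟩ := exists_tsum_kernelBound_le d β
  refine ⟨C₁, fun θ hθ => ?_⟩
  have hβ' : (0 : ℝ) < β := hβ
  -- Chosen so that `β C (K - 1) = θ + 1`: torus loops of length at least `K V` have energy at least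
  -- `(θ + 1)` times their length.
  set K : ℝ := 1 + (θ + 1) / (β * C) with hK
  have hK1 : 1 ≤ K := by
    have : 0 ≤ (θ + 1) / (β * C) := by positivity
    linarith
  obtain ⟨C₂, hC₂, hsum⟩ := hsum K hK1
  refine ⟨C₂, fun bc a ha m X hm hX hle hint c => ?_⟩
  have ha0 : 0 < a := by linarith
  have := sigmaFinite_intensity (β := β) hd hβ hW bc ha0
  set V := boxVolume d a with hV
  have hV0 : 0 < V := pow_pos (by linarith) d
  set h : Path d β → ℝ≥0∞ := fun f =>
    if bc = .per ∧ K * V ≤ (f.1 : ℝ) then ENNReal.ofReal (Real.exp (-(f.1 : ℝ))) else 1 + X f with hh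
  have hmeas : Measurable h := measurable_sigma_of fun k => by
    by_cases hk : bc = .per ∧ K * V ≤ (k : ℝ)
    · simp only [hh, if_pos hk]
      exact measurable_const
    · simp only [hh, if_neg hk]
      exact measurable_const.add (hX.comp (measurable_sigmaMk k))
  have hself : ∀ f : Path d β,
      ENNReal.ofReal (Real.exp (θ * m f - selfEnergy (bcPotential bc a v) f)) ≤ h f := by
    intro f
    by_cases hf : bc = .per ∧ K * V ≤ (f.1 : ℝ)
    · simp only [hh, if_pos hf]
      obtain ⟨rfl, hf⟩ := hf
      apply ENNReal.ofReal_le_ofReal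
      apply Real.exp_le_exp.2
      have h1 := selfEnergy_per_ge hv hC ha f
      rw [← hV] at h1
      have h2 : θ * m f ≤ θ * f.1 := by
        gcongr
        exact hm f
      have h3 : K ≤ f.1 / V := by rwa [le_div_iff₀ hV0]
      have h4 : (θ + 1) * f.1 ≤ β * (C * ((f.1 : ℝ) ^ 2 / V - f.1)) := by
        calc (θ + 1) * f.1 = β * (C * ((K - 1) * f.1)) := by rw [hK]; field_simp; ring
          _ ≤ β * (C * ((f.1 / V - 1) * f.1)) := by gcongr
          _ = _ := by ring
      linarith
    · simp only [hh, if_neg hf]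
      exact hle f
  have hterm : ∀ k : ℕ, 1 ≤ k → ∫⁻ x in cube (0 : Space d) a,
      ∫⁻ f, h ⟨k, f⟩ ∂bcBridgeMeasure W β bc a k x x ≤ ENNReal.ofReal (V *
        ((if bc = .per ∧ K * V ≤ (k : ℝ) then Real.exp (-(k : ℝ)) else 2)
          * kernelBound d β bc a k)) := by
    intro k hk
    have hkb := kernelBound_nonneg (d := d) (β := β) (bc := bc) ha0 k
    by_cases hf : bc = .per ∧ K * V ≤ (k : ℝ)
    · simp only [hh, if_pos hf]
      exact lintegral_cube_const_le hd hβ hW bc ha0 hk (Real.exp_pos _).le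
    · simp only [hh, if_neg hf]
      calc _ ≤ ∫⁻ x in cube (0 : Space d) a, (ENNReal.ofReal (1 * kernelBound d β bc a k)
            + ∫⁻ f, X ⟨k, f⟩ ∂bcBridgeMeasure W β bc a k x x) := by
            gcongr with x
            rw [lintegral_add_left measurable_const]
            gcongr
            refine le_trans (le_of_eq ?_) (lintegral_bcBridgeMeasure_le hd hβ W bc ha0 hk x
              zero_le_one fun y => lintegral_bridgeMeasure_const_le hd hW k x y zero_le_one)
            rw [ENNReal.ofReal_one]
        _ ≤ _ := by
            rw [lintegral_add_left measurable_const, setLIntegral_const, volume_cube _ ha0.le]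
            refine (add_le_add_right (hint k hk) _).trans (le_of_eq ?_)
            change _ * ENNReal.ofReal V + _ = _
            rw [← ENNReal.ofReal_mul (by positivity),
              ← ENNReal.ofReal_add (by positivity) (by positivity)]
            congr 1; ring
  have hnu : ∫⁻ z, h z.2 ∂intensity W β bc a ≤ ENNReal.ofReal (C₁ * V + C₂) := by
    refine (lintegral_intensity_le W bc a _).trans (le_trans ?_ (hsum bc a ha))
    refine ENNReal.tsum_le_tsum fun k => ?_
    have hk : (0 : ℝ) < ((k : ℕ) : ℝ) := by exact_mod_cast k.pos
    rw [ENNReal.ofReal_mul (by positivity), ENNReal.ofReal_inv_of_pos hk, ENNReal.ofReal_natCast]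
    gcongr
    exact hterm k k.pos
  unfold transformedLaw
  refine tilted_poissonWeight_le (intensity W β bc a) (H := boltzmann (bcPotential bc a v))
    (fun z => ?_) (fun z => m z.2) (fun z => selfEnergy (bcPotential bc a v) z.2) (fun ω => ?_) hθ
    (hmeas.comp measurable_snd) (fun z => hself z.2) (by positivity) hnu c
  · simp [boltzmann, interaction]
  · apply ENNReal.ofReal_le_ofReal
    apply Real.exp_le_exp.2
    exact neg_le_neg (sum_selfEnergy_le_interaction (bcPotential_nonneg hv bc a) ω)

end Soup

/-! ### Long noncrossing loops -/

section NonCrossing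

variable {d : ℕ} {β : ℝ≥0}

theorem selfEnergy_nonneg {V : Space d → ℝ} (hV : ∀ y, 0 ≤ V y) (f : Path d β) :
    0 ≤ selfEnergy V f :=
  Finset.sum_nonneg fun i _ => Finset.sum_nonneg fun j _ => by
    have := legInteraction_nonneg hV f f i j
    split_ifs <;> positivity

theorem exp_neg_selfEnergy_le_one {V : Space d → ℝ} (hV : ∀ y, 0 ≤ V y) (f : Path d β) :
    ENNReal.ofReal (Real.exp (-selfEnergy V f)) ≤ 1 := by
  rw [← ENNReal.ofReal_one]
  exact ENNReal.ofReal_le_ofReal (Real.exp_le_one_iff.2 (neg_nonpos.2 (selfEnergy_nonneg hV f)))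

instance sFinite_bridgeMeasure (W : Measure C(ℝ≥0, Space d)) [IsProbabilityMeasure W] (k : ℕ)
    (x y : Space d) : SFinite (bridgeMeasure W β k x y) := by
  unfold bridgeMeasure
  infer_instance

/-- Tonelli's theorem reduces this to the moments at fixed `s`, whose growth `displacementRate ^ k`
is absorbed by `exp(t k)`. -/
theorem lintegral_average_displacement_le (hd : 1 ≤ d) {W : Measure C(ℝ≥0, Space d)}
    (hW : IsWienerMeasure W) (hβ : 0 < β) {k : ℕ} (hk : 1 ≤ k) (x y : Space d) {t : ℝ}
    (ht : t + Real.log (displacementRate d β) ≤ 0) :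
    ∫⁻ f, ENNReal.ofReal (Real.exp (t * k) * (β : ℝ)⁻¹)
        * (∫⁻ s in Set.Ioc (0 : ℝ) β, ENNReal.ofReal (Real.exp (displacement s ⟨k, f⟩)))
          ∂bridgeMeasure W β k x y
      ≤ ENNReal.ofReal (1 * gaussBound d β k x y) := by
  have := hW.isProbabilityMeasure hd
  have hβ' : (0 : ℝ) < β := hβ
  have hA : 0 < displacementRate d β := by linarith [one_le_displacementRate (β := β) hd]
  have hg : 0 ≤ gaussBound d β k x y := by unfold gaussBound; positivity
  have hm : Measurable fun p : ℝ × PathSpace d β k =>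
      ENNReal.ofReal (Real.exp (displacement p.1 ⟨k, p.2⟩)) :=
    (Real.measurable_exp.comp (measurable_displacement_uncurry k)).ennreal_ofReal
  rw [lintegral_const_mul _ hm.lintegral_prod_left', lintegral_lintegral_swap
    (f := fun (f : PathSpace d β k) (s : ℝ) => ENNReal.ofReal (Real.exp (displacement s ⟨k, f⟩)))
    (hm.comp measurable_swap).aemeasurable]
  calc _ ≤ ENNReal.ofReal (Real.exp (t * k) * (β : ℝ)⁻¹) * ∫⁻ _ in Set.Ioc (0 : ℝ) β,
        ENNReal.ofReal (displacementRate d β ^ k * gaussBound d β k x y) := by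
        refine mul_le_mul_right (setLIntegral_mono measurable_const fun s hs => ?_) _
        exact lintegral_exp_displacement_le hd hW hβ hk hs.1.le hs.2 x y
    _ = ENNReal.ofReal ((Real.exp (t * k) * displacementRate d β ^ k) * gaussBound d β k x y) := by
        rw [setLIntegral_const, Real.volume_Ioc, sub_zero, ← ENNReal.ofReal_mul (by positivity),
          ← ENNReal.ofReal_mul (by positivity)]
        congr 1
        field_simp
    _ ≤ _ := by
        apply ENNReal.ofReal_le_ofReal
        gcongr
        rw [← Real.exp_log hA, ← Real.exp_nat_mul, ← Real.exp_add,
          Real.exp_le_one_iff]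
        have : (0 : ℝ) ≤ k := Nat.cast_nonneg k
        nlinarith

open Classical in
theorem exists_particlesNonCrossingGt_le (hd : 1 ≤ d) (hβ : 0 < β) {W : Measure C(ℝ≥0, Space d)}
    (hW : IsWienerMeasure W) {v : Space d → ℝ} (hv : AssumptionV v) {C : ℝ} (hC0 : 0 < C)
    (hC : Superstable C v) :
    ∃ C₁ : ℝ, ∀ R : ℕ, ∃ (L : ℕ) (C₂ : ℝ), R ≤ L ∧ ∀ (bc : BC) (a r : ℝ), 1 ≤ a → 0 ≤ r →
      r ≤ R + 1 → ∀ c : ℝ,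
      transformedLaw W β v bc a {ω | c < (particlesNonCrossingGt bc a r L ω : ℝ)}
        ≤ ENNReal.ofReal (Real.exp (-(R * c) + (C₁ * boxVolume d a + C₂))) := by
  obtain ⟨C₁, hmain⟩ := exists_transformedLaw_le hd hβ hW hv hC0 hC
  refine ⟨C₁, fun R => ?_⟩
  have hβ' : (0 : ℝ) < β := hβ
  obtain ⟨C₂, hmain⟩ := hmain R (Nat.cast_nonneg R)
  have hlog : 0 ≤ Real.log (displacementRate d β) := Real.log_nonneg (one_le_displacementRate hd)
  -- Makes `R - D / 4` plus the logarithm of the moment growth rate equal to `-1/4`.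
  set D : ℝ := 4 * (R + Real.log (displacementRate d β)) + 1 with hD
  have hD1 : 1 ≤ D := by
    have : (0 : ℝ) ≤ R := Nat.cast_nonneg R
    linarith
  set B : ℝ := (2 * (R + 1 + D)) ^ d with hB
  have hB0 : 0 < B := by positivity
  -- Beyond this length `β C (k / (2B) - 1) ≥ R` in every enlarged subbox with `r ≤ R + 1`; the
  -- maximum with `R` makes the levels tend to infinity.
  set L : ℕ := max R ⌈2 * B * (R / (β * C) + 1)⌉₊ with hL
  refine ⟨L, C₂, le_max_left _ _, fun bc a r ha hr hrR c => ?_⟩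
  have ha0 : 0 < a := by linarith
  have hnn := bcPotential_nonneg hv bc a
  refine hmain bc a ha (fun f => if NonCrossing bc a r f ∧ L < f.1 then f.1 else 0)
    (fun f => ENNReal.ofReal (Real.exp ((R - D / 4) * f.1) * (β : ℝ)⁻¹)
        * ∫⁻ s in Set.Ioc (0 : ℝ) β, ENNReal.ofReal (Real.exp (displacement s f)))
    (fun f => ?_) (measurable_sigma_of fun k => ?_) (fun f => ?_) (fun k hk => ?_) c
  · split_ifs
    · exact le_rfl
    · exact Nat.zero_le _
  · have hm : Measurable fun p : ℝ × PathSpace d β k =>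
        ENNReal.ofReal (Real.exp (displacement p.1 ⟨k, p.2⟩)) :=
      (Real.measurable_exp.comp (measurable_displacement_uncurry k)).ennreal_ofReal
    exact (hm.lintegral_prod_left' (μ := volume.restrict (Set.Ioc (0 : ℝ) β))).const_mul
      (ENNReal.ofReal (Real.exp ((R - D / 4) * (k : ℝ)) * (β : ℝ)⁻¹))
  · by_cases hf : NonCrossing bc a r f ∧ L < f.1
    · simp only [if_pos hf]
      refine exp_sub_selfEnergy_le hv hC0.le hC bc ha0 hβ hr hD1 f hf.1 ?_
      have h1 : 2 * B * (R / (β * C) + 1) ≤ f.1 :=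
        (Nat.le_ceil _).trans (by exact_mod_cast (le_max_right _ _).trans hf.2.le)
      calc (R : ℝ) = β * (C * (1 / 2 * (2 * B * (R / (β * C) + 1)) / B - 1)) := by
            field_simp; ring
        _ ≤ β * (C * (1 / 2 * (f.1 : ℝ) / B - 1)) := by gcongr
        _ ≤ _ := by
            rw [hB]
            gcongr
    · simp only [if_neg hf, Nat.cast_zero, mul_zero, zero_sub]
      exact (exp_neg_selfEnergy_le_one hnn f).trans le_self_add
  · calc _ ≤ ∫⁻ _ in cube (0 : Space d) a, ENNReal.ofReal (1 * kernelBound d β bc a k) := by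
          gcongr with x
          exact lintegral_bcBridgeMeasure_le hd hβ W bc ha0 hk x zero_le_one fun y =>
            lintegral_average_displacement_le hd hW hβ hk x y (by rw [hD]; linarith)
      _ = _ := by
          have : 0 ≤ boxVolume d a := by unfold boxVolume; positivity
          rw [setLIntegral_const, volume_cube _ ha0.le, mul_comm, ENNReal.ofReal_mul this, one_mul]
          rfl

end NonCrossing

/-! ### Short crossing loops -/

section Crossing

variable {d : ℕ} {β : ℝ≥0}

/-- At `s = β` the displacement adds up the steps between consecutive particles, so this is a
telescoping sum. -/
theorem abs_eval_sub_le_displacement (f : Path d β) {l : ℕ} (hl : l < f.1) (c : Fin d) :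
    |f.eval (l * β) c - f.eval 0 c| ≤ displacement β f := by
  have h := Finset.sum_range_sub (fun i : ℕ => f.eval (i * β) c) l
  simp only [Nat.cast_zero, zero_mul] at h
  rw [← h]
  calc _ ≤ ∑ i ∈ Finset.range l, |f.eval ((i + 1 : ℕ) * β) c - f.eval (i * β) c| :=
        Finset.abs_sum_le_sum_abs _ _
    _ ≤ ∑ i ∈ Finset.range f.1, |f.eval ((i + 1 : ℕ) * β) c - f.eval (i * β) c| :=
        Finset.sum_le_sum_of_subset_of_nonneg (Finset.range_subset_range.2 hl.le)
          fun _ _ _ => abs_nonneg _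
    _ ≤ _ := by
        refine Finset.sum_le_sum fun i _ => ?_
        have : ((i + 1 : ℕ) : ℝ) * β = i * β + β := by push_cast; ring
        rw [this]
        exact Finset.single_le_sum (f := fun c => |f.eval (i * β + β) c - f.eval (i * β) c|)
          (fun c _ => abs_nonneg _) (Finset.mem_univ c)

/-- The strict inequality matters on the torus: representatives lie in `[-a, a)`, so the face at `a`
is moved to `-a`. -/
theorem position_eq_self (bc : BC) {a : ℝ} {y : Space d} (hy : ∀ i, |y i| < a) :
    position bc a y = y := by
  cases bc with
  | per =>
    ext i
    have h := abs_lt.1 (hy i)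
    have h0 : ⌊(y i + a) / (2 * a)⌋ = 0 := by
      rw [Int.floor_eq_zero_iff]
      have h2a : 0 < 2 * a := by linarith [abs_nonneg (y i), hy i]
      exact ⟨div_nonneg (by linarith) h2a.le, (div_lt_one h2a).2 (by linarith)⟩
    simp [position, h0]
  | zero => rfl
  | par => rfl

/-- The points at distance at least `D` from the faces of the subboxes. -/
def deepPoints (Z : Set (Fin d → ℤ)) (r D : ℝ) : Set (Space d) :=
  ⋃ n ∈ Z, cube (latticePoint (2 * r) n) (r - D)

/-- No particle can cover the distance `D` to the faces. All particles stay in the open subbox,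
hence in the interior of `Λ`, where periodic representatives are trivial. -/
theorem nonCrossing_of_deep (bc : BC) {a r D : ℝ} (hr : 0 < r) {Z : Set (Fin d → ℤ)}
    (hZ : cube (0 : Space d) a = ⋃ n ∈ Z, cube (latticePoint (2 * r) n) r) (f : Path d β)
    (h0 : f.eval 0 ∈ deepPoints Z r D) (hf : displacement β f < D) : NonCrossing bc a r f := by
  obtain ⟨n, hn, h0⟩ := Set.mem_iUnion₂.1 h0
  have hsub : cube (latticePoint (2 * r) n) r ⊆ cube (0 : Space d) a :=
    hZ ▸ Set.subset_biUnion_of_mem (u := fun n => cube (latticePoint (2 * r) n) r) hn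
  -- Two opposite corners of the subbox lie in `Λ`; together they bound each coordinate of its
  -- points.
  have hplus : ∀ i, |2 * r * (n i : ℝ) + r| ≤ a := fun i => by
    have := hsub (show WithLp.toLp 2 (fun i => 2 * r * (n i : ℝ) + r) ∈ _ from fun j => by
      simp [latticePoint, abs_of_pos hr]) i
    simpa using this
  have hminus : ∀ i, |2 * r * (n i : ℝ) - r| ≤ a := fun i => by
    have := hsub (show WithLp.toLp 2 (fun i => 2 * r * (n i : ℝ) - r) ∈ _ from fun j => by
      simp [latticePoint, abs_of_pos hr]) i
    simpa using this
  refine ⟨n, fun l hl => ?_⟩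
  have hin : ∀ i, |f.eval (l * β) i - 2 * r * (n i : ℝ)| < r := fun i => by
    have h1 := abs_eval_sub_le_displacement f hl i
    have h2 := h0 i
    simp only [latticePoint] at h2
    calc _ = |(f.eval (l * β) i - f.eval 0 i) + (f.eval 0 i - 2 * r * (n i : ℝ))| := by
          congr 1; ring
      _ ≤ _ := abs_add_le _ _
      _ < r := by linarith
  rw [position_eq_self bc fun i => ?_]
  · exact fun i => (hin i).le
  · have h1 := abs_lt.1 (hin i)
    have h2 := abs_le.1 (hplus i)
    have h3 := abs_le.1 (hminus i)
    exact abs_lt.2 ⟨by linarith, by linarith⟩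

/-- In each subbox the shell has relative volume `1 - (1 - D / r)^d ≤ d D / r` by Bernoulli's
inequality, and the subboxes have total volume at most `|Λ|`. -/
theorem volume_diff_deepPoints_le {a r D : ℝ} (ha : 0 ≤ a) (hD : 0 ≤ D) (hDr : D ≤ r) (hr : 0 < r)
    {Z : Set (Fin d → ℤ)}
    (hZ : cube (0 : Space d) a = ⋃ n ∈ Z, cube (latticePoint (2 * r) n) r) :
    volume (cube (0 : Space d) a \ deepPoints Z r D)
      ≤ ENNReal.ofReal (d * D / r * boxVolume d a) := by
  -- Open subboxes: the closed ones share faces and are not disjoint.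
  let U : (Fin d → ℤ) → Set (Space d) := fun n =>
    (WithLp.ofLp : Space d → Fin d → ℝ) ⁻¹' Metric.ball (fun i => 2 * r * (n i : ℝ)) r
  have hUm : ∀ n, MeasurableSet (U n) := fun n =>
    (WithLp.measurable_ofLp 2 _) Metric.isOpen_ball.measurableSet
  have hU : ∀ n, volume (U n) = ENNReal.ofReal ((2 * r) ^ d) := fun n => by
    rw [(PiLp.volume_preserving_ofLp (Fin d)).measure_preimage
      Metric.isOpen_ball.measurableSet.nullMeasurableSet, Real.volume_pi_ball _ hr,
      Fintype.card_fin]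
  have hmemU : ∀ n y, y ∈ U n ↔ ∀ i, |y i - 2 * r * (n i : ℝ)| < r := fun n y => by
    simp only [U, Set.mem_preimage, Metric.mem_ball, dist_pi_lt_iff hr, Real.dist_eq]
  have hdisj : Pairwise fun n m : Z => Disjoint (U n) (U m) := by
    intro n m hnm
    refine Set.disjoint_left.2 fun y hn hm => hnm (Subtype.ext (funext fun i => ?_))
    have h1 := abs_lt.1 ((hmemU _ _).1 hn i)
    have h2 := abs_lt.1 ((hmemU _ _).1 hm i)
    have h3 : ((n.1 i : ℤ) : ℝ) < m.1 i + 1 := by nlinarith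
    have h4 : ((m.1 i : ℤ) : ℝ) < n.1 i + 1 := by nlinarith
    have h3' : n.1 i < m.1 i + 1 := by exact_mod_cast h3
    have h4' : m.1 i < n.1 i + 1 := by exact_mod_cast h4
    omega
  have hcount : ∑' _ : Z, ENNReal.ofReal ((2 * r) ^ d) ≤ ENNReal.ofReal (boxVolume d a) := by
    calc _ = ∑' n : Z, volume (U n) := by simp only [hU]
      _ = volume (⋃ n : Z, U n) := (measure_iUnion hdisj fun n => hUm n).symm
      _ ≤ volume (cube (0 : Space d) a) := by
          refine measure_mono (Set.iUnion_subset fun n y hy => ?_)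
          rw [hZ]
          exact Set.mem_iUnion₂.2 ⟨n, n.2, fun i => ((hmemU _ _).1 hy i).le⟩
      _ = _ := by rw [volume_cube _ ha]; rfl
  have hrD : 0 ≤ r - D := by linarith
  have hfrac : 0 ≤ d * D / r := by positivity
  have hshell : ∀ n : Fin d → ℤ, volume (cube (latticePoint (2 * r) n) r
      \ cube (latticePoint (2 * r) n) (r - D))
      ≤ ENNReal.ofReal (d * D / r) * ENNReal.ofReal ((2 * r) ^ d) := by
    intro n
    rw [measure_sdiff (fun y hy i => (hy i).trans (by linarith))
      (measurableSet_cube _ _).nullMeasurableSet (by rw [volume_cube _ hrD]; exact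
        ENNReal.ofReal_ne_top), volume_cube _ hr.le, volume_cube _ hrD,
      ← ENNReal.ofReal_sub _ (by positivity), ← ENNReal.ofReal_mul hfrac]
    apply ENNReal.ofReal_le_ofReal
    have h1 : 1 + d * (-(D / r)) ≤ (1 + -(D / r)) ^ d :=
      one_add_mul_le_pow (by have : D / r ≤ 1 := (div_le_one hr).2 hDr
                             linarith) d
    have h2 : (2 * (r - D)) ^ d = (2 * r) ^ d * (1 + -(D / r)) ^ d := by
      rw [← mul_pow]; congr 1; field_simp; ring
    rw [h2]
    have h3 : 0 ≤ (2 * r) ^ d := by positivity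
    have h4 := mul_le_mul_of_nonneg_left h1 h3
    have h5 : d * D / r * (2 * r) ^ d = (2 * r) ^ d - (2 * r) ^ d * (1 + d * (-(D / r))) := by
      field_simp; ring
    linarith
  calc _ ≤ volume (⋃ n : Z, cube (latticePoint (2 * r) (n : Fin d → ℤ)) r
        \ cube (latticePoint (2 * r) (n : Fin d → ℤ)) (r - D)) := by
        refine measure_mono fun y hy => ?_
        obtain ⟨n, hn, hyn⟩ := Set.mem_iUnion₂.1 (hZ ▸ hy.1)
        exact Set.mem_iUnion.2 ⟨⟨n, hn⟩, hyn, fun h => hy.2 (Set.mem_iUnion₂.2 ⟨n, hn, h⟩)⟩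
    _ ≤ ∑' n : Z, volume (cube (latticePoint (2 * r) (n : Fin d → ℤ)) r
        \ cube (latticePoint (2 * r) (n : Fin d → ℤ)) (r - D)) := measure_iUnion_le _
    _ ≤ ∑' _ : Z, ENNReal.ofReal (d * D / r) * ENNReal.ofReal ((2 * r) ^ d) :=
        ENNReal.tsum_le_tsum fun n => hshell n
    _ ≤ ENNReal.ofReal (d * D / r) * ENNReal.ofReal (boxVolume d a) := by
        rw [ENNReal.tsum_mul_left]
        gcongr
    _ = _ := (ENNReal.ofReal_mul hfrac).symm

theorem measurableSet_deepPoints (Z : Set (Fin d → ℤ)) (r D : ℝ) :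
    MeasurableSet (deepPoints Z r D) :=
  MeasurableSet.biUnion (Set.to_countable Z) fun _ _ => measurableSet_cube _ _

theorem lintegral_crossingBound_le (hd : 1 ≤ d) {W : Measure C(ℝ≥0, Space d)}
    (hW : IsWienerMeasure W) (hβ : 0 < β) {k : ℕ} (hk : 1 ≤ k) (x y : Space d)
    {G : Set (Space d)} (hG : MeasurableSet G) {b t : ℝ} (hb : 0 ≤ b) (ht : 0 ≤ t) :
    ∫⁻ f : PathSpace d β k, ENNReal.ofReal b * (G.indicator 1 (Path.eval ⟨k, f⟩ 0)
        + ENNReal.ofReal t * ENNReal.ofReal (Real.exp (displacement β ⟨k, f⟩)))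
          ∂bridgeMeasure W β k x y
      ≤ ENNReal.ofReal (b * (G.indicator 1 x + t * displacementRate d β ^ k)
        * gaussBound d β k x y) := by
  have hA : 0 < displacementRate d β := by linarith [one_le_displacementRate (β := β) hd]
  have hg : 0 ≤ gaussBound d β k x y := by unfold gaussBound; positivity
  have hm : Measurable fun f : PathSpace d β k =>
      ENNReal.ofReal (Real.exp (displacement β ⟨k, f⟩)) :=
    (Real.measurable_exp.comp (measurable_displacement k β)).ennreal_ofReal
  have hind : (0 : ℝ) ≤ G.indicator 1 x := Set.indicator_nonneg (fun _ _ => zero_le_one) x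
  have hofReal : (G.indicator 1 x : ℝ≥0∞) = ENNReal.ofReal (G.indicator 1 x) := by
    by_cases hx : x ∈ G <;> simp [hx]
  rw [lintegral_const_mul' _ _ ENNReal.ofReal_ne_top, lintegral_add_right _ (hm.const_mul _),
    lintegral_const_mul _ hm]
  calc _ ≤ ENNReal.ofReal b * (G.indicator 1 x * ENNReal.ofReal (gaussBound d β k x y)
        + ENNReal.ofReal t * ENNReal.ofReal (displacementRate d β ^ k * gaussBound d β k x y)) := by
        gcongr
        · exact lintegral_eval_zero_le hd hW k x y _ (measurable_one.indicator hG)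
        · exact lintegral_exp_displacement_le hd hW hβ hk β.2 le_rfl x y
    _ = _ := by
        rw [hofReal, ← ENNReal.ofReal_mul hind, ← ENNReal.ofReal_mul ht,
          ← ENNReal.ofReal_add (by positivity) (by positivity), ← ENNReal.ofReal_mul hb]
        congr 1; ring

open Classical in
-- The tilt parameter is `L` itself, so `exp(θ m) ≤ exp(L * L)`. The smallness hypothesis says that
-- crossing is unlikely enough to offset this factor.
theorem exists_particlesCrossingLe_le (hd : 1 ≤ d) (hβ : 0 < β) {W : Measure C(ℝ≥0, Space d)}
    (hW : IsWienerMeasure W) {v : Space d → ℝ} (hv : AssumptionV v) {C : ℝ} (hC0 : 0 < C)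
    (hC : Superstable C v) :
    ∃ C₁ : ℝ, ∀ L : ℕ, ∃ C₂ : ℝ, ∀ (bc : BC) (a r D : ℝ), 1 ≤ a → 0 < r → 0 ≤ D → D ≤ r →
      IsPartitioned d a r →
      Real.exp (L * L) * (d * D / r + Real.exp (-D) * displacementRate d β ^ L) ≤ 1 → ∀ c : ℝ,
      transformedLaw W β v bc a {ω | c < (particlesCrossingLe bc a r L ω : ℝ)}
        ≤ ENNReal.ofReal (Real.exp (-(L * c) + (C₁ * boxVolume d a + C₂))) := by
  obtain ⟨C₁, hmain⟩ := exists_transformedLaw_le hd hβ hW hv hC0 hC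
  refine ⟨C₁, fun L => ?_⟩
  obtain ⟨C₂, hmain⟩ := hmain L (Nat.cast_nonneg L)
  refine ⟨C₂, fun bc a r D ha hr hD hDr hpart hsmall c => ?_⟩
  obtain ⟨Z, hZ⟩ := hpart
  have ha0 : 0 < a := by linarith
  have hA1 := one_le_displacementRate (β := β) hd
  have hV0 : 0 < boxVolume d a := pow_pos (by linarith) d
  have hnn := bcPotential_nonneg hv bc a
  set G : Set (Space d) := (deepPoints Z r D)ᶜ with hG
  have hGm : MeasurableSet G := (measurableSet_deepPoints Z r D).compl
  set b : ℝ := Real.exp (L * L) with hb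
  have hb0 : 0 < b := Real.exp_pos _
  refine hmain bc a ha (fun f => if ¬ NonCrossing bc a r f ∧ f.1 ≤ L then f.1 else 0)
    (fun f => if f.1 ≤ L then ENNReal.ofReal b * (G.indicator 1 (f.eval 0)
      + ENNReal.ofReal (Real.exp (-D)) * ENNReal.ofReal (Real.exp (displacement β f))) else 0)
    (fun f => ?_) (measurable_sigma_of fun k => ?_) (fun f => ?_) (fun k hk => ?_) c
  · split_ifs
    · exact le_rfl
    · exact Nat.zero_le _
  · by_cases hkL : k ≤ L
    · simp only [if_pos hkL]
      refine measurable_const.mul (Measurable.add ?_ (measurable_const.mul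
        (Real.measurable_exp.comp (measurable_displacement k β)).ennreal_ofReal))
      exact (measurable_one.indicator hGm).comp
        (measurable_evalMap (T := Set.Iic ((k : ℝ≥0) * β)) (d := d)
          ⟨min (0 : ℝ).toNNReal ((k : ℝ≥0) * β), Set.mem_Iic.2 (min_le_right _ _)⟩)
    · simp only [if_neg hkL]
      exact measurable_const
  · by_cases hf : ¬ NonCrossing bc a r f ∧ f.1 ≤ L
    · simp only [if_pos hf, if_pos hf.2]
      refine le_trans ?_ le_add_self
      have h1 : Real.exp (L * f.1 - selfEnergy (bcPotential bc a v) f) ≤ b := by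
        apply Real.exp_le_exp.2
        have h2 : (L : ℝ) * f.1 ≤ L * L := by
          gcongr
          exact_mod_cast hf.2
        linarith [selfEnergy_nonneg hnn f]
      refine (ENNReal.ofReal_le_ofReal h1).trans (le_mul_of_one_le_right zero_le ?_)
      -- A crossing loop starts near a face or has displacement at least `D`, so one of the two
      -- summands is at least `1`.
      by_cases h0 : f.eval 0 ∈ G
      · rw [Set.indicator_of_mem h0]
        exact le_self_add
      · refine le_trans ?_ le_add_self
        have h2 : D ≤ displacement β f := by
          by_contra hlt
          exact hf.1 (nonCrossing_of_deep bc hr hZ f (not_not.1 h0) (not_le.1 hlt))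
        rw [← ENNReal.ofReal_mul (Real.exp_pos _).le, ← Real.exp_add, ENNReal.one_le_ofReal,
          Real.one_le_exp_iff]
        linarith
    · simp only [if_neg hf, Nat.cast_zero, mul_zero, zero_sub]
      exact (exp_neg_selfEnergy_le_one hnn f).trans le_self_add
  · have hkb := kernelBound_nonneg (d := d) (β := β) (bc := bc) ha0 k
    by_cases hkL : k ≤ L
    · simp only [if_pos hkL]
      set J := kernelBound d β bc a k with hJ
      have hind : ∀ x, (0 : ℝ) ≤ G.indicator 1 x := fun x =>
        Set.indicator_nonneg (fun _ _ => zero_le_one) x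
      have hofReal : ∀ x, ENNReal.ofReal (G.indicator 1 x) = G.indicator 1 x := fun x => by
        by_cases hx : x ∈ G <;> simp [hx]
      calc _ ≤ ∫⁻ x in cube (0 : Space d) a, ENNReal.ofReal (b * (G.indicator 1 x
            + Real.exp (-D) * displacementRate d β ^ k) * J) := by
            gcongr with x
            refine lintegral_bcBridgeMeasure_le hd hβ W bc ha0 hk x ?_ fun y =>
              lintegral_crossingBound_le hd hW hβ hk x y hGm hb0.le (Real.exp_pos _).le
            have := hind x
            positivity
        _ = ∫⁻ x in cube (0 : Space d) a, (ENNReal.ofReal (b * J) * G.indicator 1 x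
            + ENNReal.ofReal (b * J * (Real.exp (-D) * displacementRate d β ^ k))) := by
            refine lintegral_congr fun x => ?_
            rw [← hofReal, ← ENNReal.ofReal_mul (by positivity),
              ← ENNReal.ofReal_add (mul_nonneg (by positivity) (hind x)) (by positivity)]
            congr 1; ring
        _ ≤ ENNReal.ofReal (b * J) * ENNReal.ofReal (d * D / r * boxVolume d a)
            + ENNReal.ofReal (b * J * (Real.exp (-D) * displacementRate d β ^ k))
              * ENNReal.ofReal (boxVolume d a) := by
            rw [lintegral_add_right _ measurable_const,
              lintegral_const_mul _ (measurable_one.indicator hGm), setLIntegral_const,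
              volume_cube _ ha0.le, lintegral_indicator_one hGm, Measure.restrict_apply hGm]
            gcongr
            · refine le_trans (measure_mono fun y hy => ?_)
                (volume_diff_deepPoints_le ha0.le hD hDr hr hZ)
              exact ⟨hy.2, hy.1⟩
            · exact le_rfl
        _ ≤ _ := by
            rw [← ENNReal.ofReal_mul (by positivity), ← ENNReal.ofReal_mul (by positivity),
              ← ENNReal.ofReal_add (by positivity) (by positivity)]
            apply ENNReal.ofReal_le_ofReal
            calc _ = b * (d * D / r + Real.exp (-D) * displacementRate d β ^ k)
                  * (boxVolume d a * J) := by ring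
              _ ≤ b * (d * D / r + Real.exp (-D) * displacementRate d β ^ L)
                  * (boxVolume d a * J) := by gcongr
              _ ≤ 1 * (boxVolume d a * J) := by gcongr
              _ = _ := one_mul _
    · simp only [if_neg hkL, lintegral_zero]
      exact zero_le

end Crossing

open Filter Topology

/-! ### Superexponential decay -/

theorem log_mul_le {Q : ℝ≥0∞} {V y : ℝ} (hV : 0 < V) (hQ : Q ≤ ENNReal.ofReal (Real.exp y)) :
    ((1 / V : ℝ) : EReal) * ENNReal.log Q ≤ ((y / V : ℝ) : EReal) := by
  have h1 : ENNReal.log Q ≤ (y : EReal) := by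
    refine (ENNReal.log_monotone hQ).trans (le_of_eq ?_)
    rw [ENNReal.log_ofReal_of_pos (Real.exp_pos y), Real.log_exp]
  refine (mul_le_mul_of_nonneg_left h1 (by exact_mod_cast (by positivity : 0 ≤ 1 / V))).trans
    (le_of_eq ?_)
  rw [← EReal.coe_mul]
  congr 1; ring

/-- For fixed `R`, eventually `C₂ R ≤ V N`, so the inner limsup is at most `-θ R ε + C₁ + 1`. Since
`C₁` does not depend on `R`, this tends to `-∞`. -/
theorem limsup_log_eq_bot {Q : ℕ → ℕ → ℝ≥0∞} {V : ℕ → ℝ} (hV : Tendsto V atTop atTop)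
    {θ : ℕ → ℝ} (hθ : Tendsto θ atTop atTop) {ε C₁ : ℝ} (hε : 0 < ε) {C₂ : ℕ → ℝ}
    (h : ∀ᶠ R in atTop, ∀ᶠ N in atTop, Q R N ≤
      ENNReal.ofReal (Real.exp (-(θ R * (ε * V N)) + (C₁ * V N + C₂ R)))) :
    limsup (fun R : ℕ => limsup (fun N : ℕ => ((1 / V N : ℝ) : EReal) * ENNReal.log (Q R N)) atTop)
      atTop = ⊥ := by
  have hR : ∀ᶠ R in atTop, limsup (fun N : ℕ => ((1 / V N : ℝ) : EReal) * ENNReal.log (Q R N)) atTop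
      ≤ ((-(θ R * ε) + (C₁ + 1) : ℝ) : EReal) := by
    filter_upwards [h] with R hQ
    refine limsup_le_of_le (h := ?_)
    filter_upwards [hQ, hV.eventually_gt_atTop 0, hV.eventually_ge_atTop (C₂ R)] with N hN h0 h1
    refine (log_mul_le h0 hN).trans (EReal.coe_le_coe_iff.2 ?_)
    rw [div_le_iff₀ h0]
    nlinarith
  have hlim : Tendsto (fun R => ((-(θ R * ε) + (C₁ + 1) : ℝ) : EReal)) atTop (𝓝 ⊥) := by
    refine EReal.tendsto_coe_nhds_bot_iff.2 ?_
    exact tendsto_atBot_add_const_right _ _ (tendsto_neg_atTop_atBot.comp (hθ.atTop_mul_const hε))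
  exact le_bot_iff.1 ((limsup_le_limsup hR).trans hlim.limsup_eq.le)

/-- A property that holds eventually for every fixed level holds along a sequence of levels that
tends to infinity slowly enough. -/
theorem exists_slow_seq {P : ℕ → ℕ → Prop} (hP : ∀ L, ∀ᶠ R in atTop, P L R) :
    ∃ L : ℕ → ℕ, Tendsto L atTop atTop ∧ ∀ᶠ R in atTop, P (L R) R := by
  classical
  choose M hM using fun L => eventually_atTop.1 (hP L)
  refine ⟨fun R => Nat.findGreatest (fun L => M L ≤ R) R, tendsto_atTop.2 fun b => ?_, ?_⟩
  · filter_upwards [eventually_ge_atTop (max b (M b))] with R hR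
    exact Nat.le_findGreatest ((le_max_left _ _).trans hR) ((le_max_right _ _).trans hR)
  · filter_upwards [eventually_ge_atTop (M 0)] with R hR
    exact hM _ R (Nat.findGreatest_spec (P := fun L => M L ≤ R) (Nat.zero_le R) hR)

/-- The smallness condition for crossing loops with `D = √R` and `r ≥ R / 2`, at a fixed level `L`.
-/
theorem eventually_crossing_small (d L : ℕ) (A : ℝ) : ∀ᶠ R : ℕ in atTop,
    Real.exp (L * L) * (2 * d * (√(R : ℝ))⁻¹ + Real.exp (-√(R : ℝ)) * A ^ L) ≤ 1 := by
  have hs : Tendsto (fun R : ℕ => √(R : ℝ)) atTop atTop :=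
    Real.tendsto_sqrt_atTop.comp tendsto_natCast_atTop_atTop
  have h1 := (tendsto_inv_atTop_zero.comp hs).const_mul (2 * d : ℝ)
  have h2 := (Real.tendsto_exp_neg_atTop_nhds_zero.comp hs).mul_const (A ^ L)
  have h3 := (h1.add h2).const_mul (Real.exp (L * L))
  simp only [mul_zero, zero_mul, add_zero] at h3
  exact (h3.eventually (gt_mem_nhds one_pos)).mono fun R hR => le_of_lt hR

theorem tendsto_boxVolume {d : ℕ} {ρ : ℝ} (hρ : 0 < ρ) {a : ℕ → ℝ}
    (hvol : Tendsto (fun N : ℕ => boxVolume d (a N) / N) atTop (𝓝 (1 / ρ))) :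
    Tendsto (fun N => boxVolume d (a N)) atTop atTop := by
  refine (hvol.pos_mul_atTop (by positivity) tendsto_natCast_atTop_atTop).congr' ?_
  filter_upwards [eventually_gt_atTop 0] with N hN
  have : (N : ℝ) ≠ 0 := by positivity
  field_simp

/-- Ensures that large boxes contain `[-1,1]^d`, as superstability requires. -/
theorem one_le_of_le_boxVolume {d : ℕ} (hd : 1 ≤ d) {a : ℝ} (ha : 0 < a)
    (h : 2 ^ d ≤ boxVolume d a) : 1 ≤ a := by
  by_contra hlt
  have : boxVolume d a < 2 ^ d := pow_lt_pow_left₀ (by linarith) (by positivity) (by omega)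
  linarith

end BoseLoops

/-! ### Choice of the levels and conclusion -/

open BoseLoops Filter

theorem lemma3p2 (d : ℕ) (hd : 1 ≤ d)
    -- Wiener measure, the inverse temperature, the pair potential, and the particle density
    (W : MeasureTheory.Measure C(NNReal, BoseLoops.Space d)) (hW : BoseLoops.IsWienerMeasure W)
    (β : NNReal) (hβ : 0 < β)
    (v : BoseLoops.Space d → ℝ) (hv : BoseLoops.AssumptionV v)
    (ρ : ℝ) (hρ : 0 < ρ)
    -- the centred boxes `Λ_N = [-a N, a N]^d`
    (a : ℕ → ℝ) (ha : ∀ N, 0 < a N)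
    (hvol : Filter.Tendsto (fun N : ℕ => BoseLoops.boxVolume d (a N) / N) Filter.atTop
      (nhds (1 / ρ))) :
    ∃ Lle Lgt : ℕ → ℕ,
      Filter.Tendsto Lle Filter.atTop Filter.atTop ∧
      Filter.Tendsto Lgt Filter.atTop Filter.atTop ∧
      -- the half side lengths `r R N → R` of the subboxes into which `Λ_N` is partitioned
      ∀ r : ℕ → ℕ → ℝ,
        (∀ R : ℕ, 1 ≤ R → Filter.Tendsto (r R) Filter.atTop (nhds (R : ℝ)) ∧
          ∀ᶠ N in Filter.atTop, BoseLoops.IsPartitioned d (a N) (r R N)) →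
      ∀ (bc : BoseLoops.BC) (ε : ℝ), 0 < ε → ε < 1 →
        Filter.limsup (fun R : ℕ => Filter.limsup (fun N : ℕ =>
          ((1 / BoseLoops.boxVolume d (a N) : ℝ) : EReal) *
            ENNReal.log (BoseLoops.transformedLaw W β v bc (a N)
              {ω | ε * BoseLoops.boxVolume d (a N) <
                (BoseLoops.particlesCrossingLe bc (a N) (r R N) (Lle R) ω : ℝ)}))
          Filter.atTop) Filter.atTop = ⊥ ∧
        Filter.limsup (fun R : ℕ => Filter.limsup (fun N : ℕ =>
          ((1 / BoseLoops.boxVolume d (a N) : ℝ) : EReal) *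
            ENNReal.log (BoseLoops.transformedLaw W β v bc (a N)
              {ω | ε * BoseLoops.boxVolume d (a N) <
                (BoseLoops.particlesNonCrossingGt bc (a N) (r R N) (Lgt R) ω : ℝ)}))
          Filter.atTop) Filter.atTop = ⊥ := by
  obtain ⟨C, hC0, hC⟩ := hv.superstable
  have hC : Superstable C v := hC
  obtain ⟨C₁, hgt⟩ := exists_particlesNonCrossingGt_le hd hβ hW hv hC0 hC
  choose Lgt C₂ hLgt hgt using hgt
  obtain ⟨C₁', hle⟩ := exists_particlesCrossingLe_le hd hβ hW hv hC0 hC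
  choose C₂' hle using hle
  obtain ⟨Lle, hLle, hsmall⟩ := exists_slow_seq fun L =>
    eventually_crossing_small d L (displacementRate d β)
  refine ⟨Lle, Lgt, hLle, tendsto_atTop_mono hLgt tendsto_id, fun r hr bc ε hε _ => ?_⟩
  have hV := tendsto_boxVolume hρ hvol
  have ha1 : ∀ᶠ N in atTop, 1 ≤ a N := by
    filter_upwards [hV.eventually_ge_atTop (2 ^ d)] with N hN
    exact one_le_of_le_boxVolume hd (ha N) hN
  -- The tilt is `θ = Lle R` for crossing loops and `θ = R` for noncrossing loops.
  refine ⟨limsup_log_eq_bot hV (tendsto_natCast_atTop_atTop.comp hLle) hε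
      (C₁ := C₁') (C₂ := fun R => C₂' (Lle R)) ?_,
    limsup_log_eq_bot hV tendsto_natCast_atTop_atTop hε (C₁ := C₁) (C₂ := C₂) ?_⟩
  · filter_upwards [hsmall, eventually_ge_atTop 4] with R hR hR4
    have hR4' : (4 : ℝ) ≤ R := by exact_mod_cast hR4
    obtain ⟨hlim, hpart⟩ := hr R (by omega)
    filter_upwards [ha1, hpart, hlim.eventually (lt_mem_nhds (show (R : ℝ) / 2 < R by linarith))]
      with N hN hpartN hrN
    have hs2 : (2 : ℝ) ≤ √(R : ℝ) := Real.le_sqrt_of_sq_le (by linarith)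
    have hsq : √(R : ℝ) * √(R : ℝ) = R := Real.mul_self_sqrt (by linarith)
    have hs0 : 0 < √(R : ℝ) := by linarith
    have hr0 : 0 < r R N := by linarith
    -- Here `D = √R`. For `R ≥ 4` it is at most `R / 2`, hence below `r R N`.
    refine hle (Lle R) bc (a N) (r R N) √(R : ℝ) hN hr0 hs0.le ?_ hpartN (le_trans ?_ hR) _
    · nlinarith
    · have h1 : d * √(R : ℝ) / r R N ≤ 2 * d * (√(R : ℝ))⁻¹ := by
        rw [div_le_iff₀ hr0]
        calc d * √(R : ℝ) = 2 * d * (√(R : ℝ))⁻¹ * (R / 2) := by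
              rw [show (R : ℝ) / 2 = √(R : ℝ) * √(R : ℝ) / 2 by rw [hsq]]; field_simp
          _ ≤ _ := by gcongr
      gcongr
  · filter_upwards [eventually_ge_atTop 1] with R hR
    have hR' : (1 : ℝ) ≤ R := by exact_mod_cast hR
    obtain ⟨hlim, -⟩ := hr R hR
    filter_upwards [ha1, hlim.eventually (lt_mem_nhds (show (0 : ℝ) < R by linarith)),
      hlim.eventually (gt_mem_nhds (show (R : ℝ) < R + 1 by linarith))] with N hN h0 h1
    exact hgt R bc (a N) (r R N) hN h0.le h1.le _
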